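/- Let $n\ge 1$. A cube is a (closed) cube in $\mathbb R^n$ with sides parallel to the axes. For $1<p<\infty$, $A_p$ is the class of almost everywhere positive, locally integrable functions $w$ on $\mathbb R^n$ with $$\|w\|_{A_p}=\sup_Q\Big(\frac1{|Q|}\int_Q w\Big)\Big(\frac1{|Q|}\int_Q w^{-1/(p-1)}\Big)^{p-1}<\infty,$$ the supremum being taken over all cubes $Q$. For a measurable $f:\mathbb R^n\to[0,\infty]$ put $\|f\|_{L^p(w)}=\big(\int_{\mathbb R^n} f^p\,w\,dx\big)^{1/p}\in[0,\infty]$. A function $\varphi:[0,\infty)\to[0,\infty)$ is called locally bounded if $\sup_{0<t<M}\varphi(t)<\infty$ for every $M$. Let $1<p_0<\infty$. (i) Let $\mathcal F$ be a family of pairs $(f,g)$ of measurable functions $\mathbb R^n\to[0,\infty]$ (for instance a single pair) such that for every $u\in A_{p_0}$ there is a constant $C_u<\infty$ with $$\|g\|_{L^{p_0}(u)}\le C_u\|f\|_{L^{p_0}(u)}\qquad\text{for all }(f,g)\in\mathcal F.$$ Then for every $1<p<\infty$ and every $w\in A_p$ there is a constant $C_w<\infty$ with $$\|g\|_{L^{p}(w)}\le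 C_w\|f\|_{L^{p}(w)}\qquad\text{for all }(f,g)\in\mathcal F.$$ (ii) Let $\varphi$ be locally bounded and $1<p<\infty$. Then there is a locally bounded $\psi$, depending only on $n,p_0,p,\varphi$, such that for all measurable $f,g:\mathbb R^n\to[0,\infty]$ with $$\|g\|_{L^{p_0}(u)}\le \varphi(\|u\|_{A_{p_0}})\|f\|_{L^{p_0}(u)}\qquad\text{for all }u\in A_{p_0}$$ we have $$\|g\|_{L^{p}(w)}\le \psi(\|w\|_{A_p})\|f\|_{L^{p}(w)}\qquad\text{for all }w\in A_p .$$ -/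

import Mathlib

open MeasureTheory
open scoped NNReal ENNReal

noncomputable section

/-- The closed cube in `ℝⁿ` with sides parallel to the axes, lower corner `a` and side length `l`. -/
def cube {n : ℕ} (a : Fin n → ℝ) (l : ℝ) : Set (Fin n → ℝ) :=
  Set.Icc a (fun i => a i + l)

/-- The Muckenhoupt constant `‖w‖_{A_p}`: the supremum over all cubes `Q` of
`(⨍_Q w) (⨍_Q w^{-1/(p-1)})^{p-1}`. -/
def apConst {n : ℕ} (p : ℝ) (w : (Fin n → ℝ) → ℝ≥0∞) : ℝ≥0∞ :=
  ⨆ (a : Fin n → ℝ) (l : ℝ) (_ : 0 < l),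
    (⨍⁻ x in cube a l, w x ∂volume) *
      (⨍⁻ x in cube a l, (w x) ^ (-(1 / (p - 1))) ∂volume) ^ (p - 1)

/-- The Muckenhoupt class `A_p` (for `1 < p < ∞`): Lebesgue measurable, almost everywhere positive,
locally integrable functions `w` (hence almost everywhere finite) with `‖w‖_{A_p} < ∞`. -/
structure IsApWeight {n : ℕ} (p : ℝ) (w : (Fin n → ℝ) → ℝ≥0∞) : Prop where
  aemeasurable : AEMeasurable w volume
  pos : ∀ᵐ x ∂(volume : Measure (Fin n → ℝ)), 0 < w x
  locallyIntegrable : ∀ K : Set (Fin n → ℝ), IsCompact K → ∫⁻ x in K, w x ∂volume < ∞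
  apConst_lt_top : apConst p w < ∞

/-- The (possibly infinite) norm `‖f‖_{L^p(w)} = (∫ f^p w dx)^{1/p}` of a nonnegative function. -/
def weightedNorm {n : ℕ} (p : ℝ) (w f : (Fin n → ℝ) → ℝ≥0∞) : ℝ≥0∞ :=
  (∫⁻ x, (f x) ^ p * w x ∂volume) ^ (1 / p)

/-- `φ` is locally bounded: `sup_{0 < t < M} φ t < ∞` for every `M`. -/
def IsLocallyBdd (φ : ℝ≥0 → ℝ≥0) : Prop :=
  ∀ M : ℝ≥0, BddAbove (φ '' Set.Ioo 0 M)

end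

/-!
The proof is Rubio de Francia's. Let `w ∈ A_p`, and let `q` be the exponent conjugate to `p`. By
duality it is enough to bound `∫ g H w` for `H` in the unit ball of `L^q(w)`, when
`F = f / ‖f‖_{L^p(w)}`. Summing a geometric series of iterates of the maximal operator `M`
(`exists_majorant_centeredMaximal_le`) gives majorants `2 a` of `F` and `2 b` of `H w`, still in the
unit balls up to a factor `2`, with `M a ≤ K a` and `M b ≤ K b`: both satisfy the `A_1` condition.
Then `u = a ^ (1 - p₀) * b` is an `A_{p₀}` weight with constant at most a power of `K`
(`IsA1.isApWeight`). Hölder's inequality for the measure `a b dx`, of mass at most `1`, bounds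
`∫ g b` by `‖g‖_{L^{p₀}(u)}`, the hypothesis replaces `g` by `f` there, and `f ≤ 2 ‖f‖ a` returns to
the mass of `a b dx` (`exists_isApWeight_forall_lintegral_mul_le`). No finiteness of `g` is needed.

The weight `u` depends on `f` and `g`, which is harmless when the constants are a function of the
`A_{p₀}` constant. When they depend on the weight arbitrarily, pairs violating the inequality with
constants `8 ^ k` are superposed with coefficients `2 ^ (-(k + 1))`: one weight then serves all of
them, which is a contradiction (`exists_weightedNorm_le_of_forall_exists`).

The analytic input is Muckenhoupt's theorem, that `M` is bounded on `L^p(w)` with a bound depending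
on the `A_p` constant only (`lintegral_centeredMaximal_rpow_mul_le`). Lerner's argument reduces it to
the centred maximal operators of the measures `w dx` and `w ^ (-1 / (p - 1)) dx`
(`centeredMaximal_rpow_le`). These are bounded on their own `L^p` spaces uniformly in the measure, by
the Besicovitch covering theorem and interpolation (`lintegral_centeredMaximal_rpow_le`). The closed
balls of `Fin n → ℝ` are cubes, since its norm is the supremum norm.
-/

/-! ### The centred maximal function of a measure -/

section CenteredMaximal

open Metric Set

variable {α : Type*} [MetricSpace α] [MeasurableSpace α]

/-- The centred maximal function of `f` with respect to a measure `μ`: the supremum over `r` of the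
`μ`-averages of `f` over the closed balls `closedBall x r`. Only rational radii are used, so that
measurability is immediate. An average over a ball of measure `0` or `∞` counts as `0`. -/
noncomputable def centeredMaximal (μ : Measure α) (f : α → ℝ≥0∞) (x : α) : ℝ≥0∞ :=
  ⨆ (r : ℚ) (_ : 0 < r), (∫⁻ y in closedBall x r, f y ∂μ) / μ (closedBall x r)

theorem div_measure_closedBall_le_centeredMaximal (μ : Measure α) (f : α → ℝ≥0∞) (x : α) {r : ℚ}
    (hr : 0 < r) :
    (∫⁻ y in closedBall x r, f y ∂μ) / μ (closedBall x r) ≤ centeredMaximal μ f x :=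
  le_iSup₂ (f := fun (r : ℚ) (_ : 0 < r) =>
    (∫⁻ y in closedBall x r, f y ∂μ) / μ (closedBall x r)) r hr

theorem measurable_setLIntegral_closedBall [SecondCountableTopology α] [BorelSpace α]
    (μ : Measure α) [SFinite μ] {f : α → ℝ≥0∞} (hf : Measurable f) (r : ℝ) :
    Measurable fun x => ∫⁻ y in closedBall x r, f y ∂μ := by
  have hS : MeasurableSet {q : α × α | dist q.2 q.1 ≤ r} :=
    (isClosed_le (continuous_snd.dist continuous_fst) continuous_const).measurableSet
  have := Measurable.lintegral_prod_right' (ν := μ)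
    ((hf.comp measurable_snd).indicator hS)
  convert this using 2 with x
  rw [← lintegral_indicator measurableSet_closedBall]
  rfl

theorem measurable_centeredMaximal [SecondCountableTopology α] [BorelSpace α]
    (μ : Measure α) [SFinite μ] {f : α → ℝ≥0∞} (hf : Measurable f) :
    Measurable (centeredMaximal μ f) := by
  refine Measurable.iSup fun r => Measurable.iSup fun _ => ?_
  refine (measurable_setLIntegral_closedBall μ hf r).div ?_
  simpa using measurable_setLIntegral_closedBall μ (f := fun _ => 1) measurable_const r

theorem centeredMaximal_tsum_le {μ : Measure α} {f : ℕ → α → ℝ≥0∞} (hf : ∀ k, Measurable (f k))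
    (x : α) :
    centeredMaximal μ (fun y => ∑' k, f k y) x ≤ ∑' k, centeredMaximal μ (f k) x := by
  refine iSup₂_le fun r hr => ?_
  rw [lintegral_tsum fun k => (hf k).aemeasurable, div_eq_mul_inv, ← ENNReal.tsum_mul_right]
  exact ENNReal.tsum_le_tsum fun k => div_measure_closedBall_le_centeredMaximal μ (f k) x hr

theorem centeredMaximal_const_mul {μ : Measure α} {f : α → ℝ≥0∞} (hf : Measurable f) (c : ℝ≥0∞)
    (x : α) :
    centeredMaximal μ (fun y => c * f y) x = c * centeredMaximal μ f x := by
  simp only [centeredMaximal, ENNReal.mul_iSup, lintegral_const_mul c hf, mul_div_assoc]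

/-- Truncating `f` at height `s` lowers its centred maximal function by at most `s`. -/
theorem centeredMaximal_le_add_indicator {μ : Measure α} (f : α → ℝ≥0∞) (s : ℝ≥0∞) (x : α) :
    centeredMaximal μ f x ≤ s + centeredMaximal μ ({y | s < f y}.indicator f) x := by
  refine iSup₂_le fun r hr => ?_
  have h1 : ∫⁻ y in closedBall x r, f y ∂μ ≤
      s * μ (closedBall x r) + ∫⁻ y in closedBall x r, {y | s < f y}.indicator f y ∂μ := by
    rw [← setLIntegral_const, ← lintegral_add_left measurable_const]
    refine lintegral_mono fun y => ?_
    by_cases h : s < f y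
    · simp [indicator, h]
    · simpa [indicator, h] using not_lt.1 h
  refine (ENNReal.div_le_div_right h1 _).trans ?_
  rw [ENNReal.add_div]
  refine add_le_add ?_ (div_measure_closedBall_le_centeredMaximal μ _ x hr)
  rw [mul_div_assoc]
  exact (mul_le_mul_right ENNReal.div_self_le_one s).trans (mul_one s).le

/-- The weak type `(1, 1)` inequality. Its constant comes from the Besicovitch covering theorem, so
it is the same for all measures. -/
theorem mul_measure_lt_centeredMaximal_le (α : Type*) [MetricSpace α] [MeasurableSpace α]
    [SecondCountableTopology α] [BorelSpace α] [HasBesicovitchCovering α] :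
    ∃ N : ℕ, ∀ (μ : Measure α) (f : α → ℝ≥0∞) (t : ℝ≥0∞),
      t * μ {x | t < centeredMaximal μ f x} ≤ N * ∫⁻ x, f x ∂μ := by
  obtain ⟨N, τ, hτ, hN⟩ := HasBesicovitchCovering.no_satelliteConfig (α := α)
  refine ⟨N, fun μ f t => ?_⟩
  -- The covering theorem needs bounded radii: exhaust the set by the points where a radius at most
  -- `R` suffices.
  let S : ℕ → Set α := fun R => {x | ∃ r : ℚ, 0 < r ∧ (r : ℝ) ≤ R ∧
    t * μ (closedBall x r) ≤ ∫⁻ y in closedBall x r, f y ∂μ}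
  have hS : {x | t < centeredMaximal μ f x} ⊆ ⋃ R, S R := by
    intro x hx
    simp only [mem_ofPred_eq, centeredMaximal, lt_iSup_iff] at hx
    obtain ⟨r, hr, h⟩ := hx
    obtain ⟨R, hR⟩ := exists_nat_ge (r : ℝ)
    exact mem_iUnion.2 ⟨R, r, hr, hR, (ENNReal.mul_lt_of_lt_div h).le⟩
  have hmono : Monotone S := by
    rintro R R' hRR' x ⟨r, hr, hrR, h⟩
    exact ⟨r, hr, hrR.trans (by exact_mod_cast hRR'), h⟩
  have key : ∀ R, t * μ (S R) ≤ N * ∫⁻ x, f x ∂μ := by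
    intro R
    choose r hr hrR hrt using fun x : S R => x.2
    let q : Besicovitch.BallPackage (S R) α :=
      { c := fun x => x, r := fun x => r x, rpos := fun x => by exact_mod_cast hr x,
        r_bound := R, r_le := hrR }
    obtain ⟨s, hdisj, hcov⟩ := Besicovitch.exist_disjoint_covering_families hτ hN q
    have hcount : ∀ i, (s i).Countable := fun i =>
      (hdisj i).countable_of_nonempty_interior fun j _ =>
        ⟨q.c j, ball_subset_interior_closedBall (mem_ball_self (q.rpos j))⟩
    have hsub : S R ⊆ ⋃ i, ⋃ j ∈ s i, closedBall (q.c j) (q.r j) := by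
      intro x hx
      have := hcov (mem_range_self (⟨x, hx⟩ : S R))
      simp only [mem_iUnion] at this ⊢
      obtain ⟨i, j, hj, h⟩ := this
      exact ⟨i, j, hj, ball_subset_closedBall h⟩
    have hfam : ∀ i, t * μ (⋃ j ∈ s i, closedBall (q.c j) (q.r j)) ≤ ∫⁻ x, f x ∂μ := by
      intro i
      calc t * μ (⋃ j ∈ s i, closedBall (q.c j) (q.r j))
          ≤ t * ∑' j : s i, μ (closedBall (q.c j) (q.r j)) :=
            mul_le_mul_right (measure_biUnion_le μ (hcount i) _) t
        _ = ∑' j : s i, t * μ (closedBall (q.c j) (q.r j)) := ENNReal.tsum_mul_left.symm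
        _ ≤ ∑' j : s i, ∫⁻ y in closedBall (q.c j) (q.r j), f y ∂μ :=
            ENNReal.tsum_le_tsum fun j => hrt j
        _ = ∫⁻ y in ⋃ j ∈ s i, closedBall (q.c j) (q.r j), f y ∂μ :=
            (lintegral_biUnion (hcount i) (fun j _ => measurableSet_closedBall) (hdisj i) f).symm
        _ ≤ ∫⁻ x, f x ∂μ := setLIntegral_le_lintegral _ _
    calc t * μ (S R) ≤ t * ∑ i, μ (⋃ j ∈ s i, closedBall (q.c j) (q.r j)) := by
          gcongr
          exact (measure_mono hsub).trans (measure_iUnion_fintype_le μ _)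
      _ = ∑ i, t * μ (⋃ j ∈ s i, closedBall (q.c j) (q.r j)) := Finset.mul_sum _ _ _
      _ ≤ ∑ _i : Fin N, ∫⁻ x, f x ∂μ := Finset.sum_le_sum fun i _ => hfam i
      _ = N * ∫⁻ x, f x ∂μ := by simp
  calc t * μ {x | t < centeredMaximal μ f x} ≤ t * μ (⋃ R, S R) := by gcongr
    _ = ⨆ R, t * μ (S R) := by rw [hmono.measure_iUnion, ENNReal.mul_iSup]
    _ ≤ N * ∫⁻ x, f x ∂μ := iSup_le key

/-- The layer cake formula for a constant. -/
theorem ENNReal.mul_lintegral_rpow_indicator_eq_rpow (a : ℝ≥0∞) {p : ℝ} (hp : 0 < p) :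
    ENNReal.ofReal p * ∫⁻ t in Ioi (0 : ℝ),
      {t : ℝ | ENNReal.ofReal t < a}.indicator (fun t => ENNReal.ofReal (t ^ (p - 1))) t = a ^ p := by
  have hfin : ∀ b : ℝ≥0, ENNReal.ofReal p * ∫⁻ t in Ioi (0 : ℝ),
      {t : ℝ | ENNReal.ofReal t < b}.indicator (fun t => ENNReal.ofReal (t ^ (p - 1))) t
        = (b : ℝ≥0∞) ^ p := by
    intro b
    have := lintegral_rpow_eq_lintegral_meas_lt_mul (Measure.dirac ()) (f := fun _ => (b : ℝ))
      (ae_of_all _ fun _ => b.2) aemeasurable_const hp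
    rw [lintegral_dirac] at this
    rw [← ENNReal.ofReal_coe_nnreal, ENNReal.ofReal_rpow_of_nonneg b.coe_nonneg hp.le, this]
    congr 1
    refine setLIntegral_congr_fun measurableSet_Ioi fun t ht => ?_
    by_cases h : t < b
    · have h' : ENNReal.ofReal t < b := by
        rw [← ENNReal.ofReal_coe_nnreal]
        exact (ENNReal.ofReal_lt_ofReal_iff_of_nonneg (le_of_lt ht)).2 h
      simp [indicator, h, h']
    · have h' : ¬ ENNReal.ofReal t < b := by
        rw [← ENNReal.ofReal_coe_nnreal,
          ENNReal.ofReal_lt_ofReal_iff_of_nonneg (le_of_lt ht)]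
        exact h
      simp [indicator, h, h']
  induction a using ENNReal.recTopCoe with
  | coe b => exact hfin b
  | top =>
    rw [ENNReal.top_rpow_of_pos hp, eq_top_iff]
    refine le_of_tendsto' (f := fun k : ℕ => ((k : ℝ≥0) : ℝ≥0∞) ^ p) (x := Filter.atTop) ?_ ?_
    · have := (ENNReal.continuous_rpow_const (y := p)).tendsto ∞
      rw [ENNReal.top_rpow_of_pos hp] at this
      exact this.comp (by simpa using ENNReal.tendsto_nat_nhds_top)
    · intro k
      rw [← hfin]
      gcongr
      exact le_top

/-- The centred maximal operator of `μ` is bounded on `L^p(μ)`, with a constant independent of `μ`: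
Marcinkiewicz interpolation between the weak type `(1, 1)` bound and the trivial bound on `L^∞`. -/
theorem lintegral_centeredMaximal_rpow_le (α : Type*) [MetricSpace α] [MeasurableSpace α]
    [SecondCountableTopology α] [BorelSpace α] [HasBesicovitchCovering α] {p : ℝ} (hp : 1 < p) :
    ∃ C : ℝ≥0, ∀ (μ : Measure α) [SFinite μ] (f : α → ℝ≥0∞), Measurable f →
      ∫⁻ x, centeredMaximal μ f x ^ p ∂μ ≤ C * ∫⁻ x, f x ^ p ∂μ := by
  obtain ⟨N, hN⟩ := mul_measure_lt_centeredMaximal_le α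
  have hp0 : 0 < p := by linarith
  have hp1 : 0 < p - 1 := by linarith
  refine ⟨Real.toNNReal p * (2 * N) * ((Real.toNNReal (p - 1))⁻¹ * 2 ^ (p - 1)),
    fun μ _ f hf => ?_⟩
  have hMf := measurable_centeredMaximal μ hf
  have hset : ∀ {g : α → ℝ≥0∞}, Measurable g →
      MeasurableSet {q : α × ℝ | ENNReal.ofReal q.2 < g q.1} := fun hg =>
    measurableSet_lt (ENNReal.measurable_ofReal.comp measurable_snd) (hg.comp measurable_fst)
  -- the weak type bound for the part of `f` above half the level
  have hlevel : ∀ t ∈ Ioi (0 : ℝ), ENNReal.ofReal (t ^ (p - 1)) *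
      μ {x | ENNReal.ofReal t < centeredMaximal μ f x} ≤ (2 * N) *
        (ENNReal.ofReal (t ^ (p - 1 - 1)) *
          ∫⁻ x, {x | ENNReal.ofReal t < 2 * f x}.indicator f x ∂μ) := by
    intro t ht
    have ht' : (0 : ℝ) < t := ht
    set s := ENNReal.ofReal (t / 2) with hs
    have hts : ENNReal.ofReal t = s + s := by
      rw [hs, ← ENNReal.ofReal_add (by positivity) (by positivity), add_halves]
    have hsfin : s ≠ ∞ := ENNReal.ofReal_ne_top
    have h1 : {x | ENNReal.ofReal t < centeredMaximal μ f x} ⊆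
        {x | s < centeredMaximal μ ({y | s < f y}.indicator f) x} := by
      intro x hx
      have := lt_of_lt_of_le hx (centeredMaximal_le_add_indicator f s x)
      rw [hts] at this
      exact lt_of_add_lt_add_left this
    have h2 : {x | ENNReal.ofReal t < 2 * f x} = {y | s < f y} := by
      ext x
      simp only [mem_ofPred_eq]
      rw [hts, ← two_mul]
      exact ENNReal.mul_lt_mul_iff_right (by simp) (by simp)
    have h3 := hN μ ({y | s < f y}.indicator f) s
    have h4 : ENNReal.ofReal (t ^ (p - 1)) = 2 * (ENNReal.ofReal (t ^ (p - 1 - 1)) * s) := by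
      rw [hs, ← ENNReal.ofReal_mul (by positivity), ← ENNReal.ofReal_ofNat,
        ← ENNReal.ofReal_mul (by norm_num)]
      congr 1
      rw [Real.rpow_sub_one ht'.ne' (p - 1)]
      field_simp
    calc ENNReal.ofReal (t ^ (p - 1)) * μ {x | ENNReal.ofReal t < centeredMaximal μ f x}
        ≤ 2 * (ENNReal.ofReal (t ^ (p - 1 - 1)) * s) *
          μ {x | s < centeredMaximal μ ({y | s < f y}.indicator f) x} := by
          rw [h4]; gcongr
      _ = 2 * ENNReal.ofReal (t ^ (p - 1 - 1)) *
          (s * μ {x | s < centeredMaximal μ ({y | s < f y}.indicator f) x}) := by ring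
      _ ≤ 2 * ENNReal.ofReal (t ^ (p - 1 - 1)) *
          (N * ∫⁻ x, {y | s < f y}.indicator f x ∂μ) := by gcongr
      _ = _ := by rw [h2]; ring
  calc ∫⁻ x, centeredMaximal μ f x ^ p ∂μ
      = ENNReal.ofReal p * ∫⁻ t in Ioi (0 : ℝ), ENNReal.ofReal (t ^ (p - 1)) *
          μ {x | ENNReal.ofReal t < centeredMaximal μ f x} := by
        simp_rw [← ENNReal.mul_lintegral_rpow_indicator_eq_rpow _ hp0]
        rw [lintegral_const_mul', lintegral_lintegral_swap]
        · congr 1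
          refine lintegral_congr fun t => ?_
          rw [← lintegral_indicator_const (measurableSet_lt measurable_const hMf)]
          rfl
        · exact Measurable.aemeasurable (Measurable.indicator (f := fun q : α × ℝ =>
            ENNReal.ofReal (q.2 ^ (p - 1))) (by fun_prop) (hset hMf))
        · exact ENNReal.ofReal_ne_top
    _ ≤ ENNReal.ofReal p * ∫⁻ t in Ioi (0 : ℝ), (2 * N) * (ENNReal.ofReal (t ^ (p - 1 - 1)) *
          ∫⁻ x, {x | ENNReal.ofReal t < 2 * f x}.indicator f x ∂μ) := by
        gcongr ENNReal.ofReal p * ?_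
        exact setLIntegral_mono' measurableSet_Ioi hlevel
    _ = ENNReal.ofReal p * (2 * N) * ∫⁻ t in Ioi (0 : ℝ), ∫⁻ x,
          f x * {t : ℝ | ENNReal.ofReal t < 2 * f x}.indicator
            (fun t => ENNReal.ofReal (t ^ (p - 1 - 1))) t ∂μ := by
        rw [lintegral_const_mul' _ _ (by finiteness), mul_assoc (ENNReal.ofReal p)]
        congr 2
        refine lintegral_congr fun t => ?_
        rw [← lintegral_const_mul' _ _ ENNReal.ofReal_ne_top]
        refine lintegral_congr fun x => ?_
        by_cases h : ENNReal.ofReal t < 2 * f x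
        · simp [indicator, mul_comm]
        · simp [indicator, h]
    _ = ENNReal.ofReal p * (2 * N) * ∫⁻ x, (f x * ∫⁻ t in Ioi (0 : ℝ),
          {t : ℝ | ENNReal.ofReal t < 2 * f x}.indicator
            (fun t => ENNReal.ofReal (t ^ (p - 1 - 1))) t) ∂μ := by
        rw [lintegral_lintegral_swap]
        · congr 1
          refine lintegral_congr fun x => ?_
          rw [lintegral_const_mul]
          exact Measurable.indicator (by fun_prop)
            (measurableSet_lt ENNReal.measurable_ofReal measurable_const)
        · refine Measurable.aemeasurable ?_
          have := ((hf.comp measurable_snd).mul (Measurable.indicator (f := fun q : α × ℝ =>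
            ENNReal.ofReal (q.2 ^ (p - 1 - 1))) (by fun_prop)
              (hset (hf.const_mul 2)) |>.comp measurable_swap) :
            Measurable fun q : ℝ × α => f q.2 * _)
          exact this
    _ = ENNReal.ofReal p * (2 * N) * ∫⁻ x, ((ENNReal.ofReal (p - 1))⁻¹ * 2 ^ (p - 1)) *
          f x ^ p ∂μ := by
        congr 1
        refine lintegral_congr fun x => ?_
        have h := ENNReal.mul_lintegral_rpow_indicator_eq_rpow (2 * f x) hp1
        have hne : ENNReal.ofReal (p - 1) ≠ 0 := by simpa using hp1
        rw [← one_mul (∫⁻ t in Ioi (0 : ℝ), _), ← ENNReal.inv_mul_cancel hne ENNReal.ofReal_ne_top,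
          mul_assoc, h, ENNReal.mul_rpow_of_nonneg _ _ hp1.le]
        have : f x ^ p = f x * f x ^ (p - 1) := by
          conv_rhs => rw [← ENNReal.rpow_one (f x), ← ENNReal.rpow_mul, one_mul]
          rw [← ENNReal.rpow_add_of_nonneg _ _ zero_le_one hp1.le, add_sub_cancel]
        rw [this]; ring
    _ = _ := by
        rw [lintegral_const_mul _ (hf.pow_const p), ← mul_assoc]
        congr 1
        have hne : Real.toNNReal (p - 1) ≠ 0 := by simpa using hp1
        push_cast [ENNReal.coe_inv hne, ENNReal.coe_rpow_of_nonneg _ hp1.le]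
        rfl

end CenteredMaximal

/-! ### Cubes as balls of the supremum norm -/

section Cubes

open Metric Set

variable {n : ℕ}

theorem closedBall_eq_cube (x : Fin n → ℝ) {r : ℝ} (hr : 0 ≤ r) :
    closedBall x r = cube (fun i => x i - r) (2 * r) := by
  ext y
  simp only [mem_closedBall, dist_pi_le_iff hr, Real.dist_eq, abs_le, cube, mem_Icc, Pi.le_def,
    ← forall_and]
  exact forall_congr' fun i => by constructor <;> rintro ⟨h1, h2⟩ <;> constructor <;> linarith

theorem cube_subset_closedBall {c : Fin n → ℝ} {l : ℝ} {x : Fin n → ℝ} (hx : x ∈ cube c l)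
    (hl : 0 ≤ l) : cube c l ⊆ closedBall x l := by
  intro y hy
  rw [mem_closedBall, dist_pi_le_iff hl]
  intro i
  have h1 := hx.1 i
  have h2 := hx.2 i
  have h3 := hy.1 i
  have h4 := hy.2 i
  simp only at h2 h4
  rw [Real.dist_eq, abs_le]
  constructor <;> linarith

theorem volume_cube (c : Fin n → ℝ) {l : ℝ} (hl : 0 ≤ l) :
    volume (cube c l) = ENNReal.ofReal (l ^ n) := by
  simp [cube, Real.volume_Icc_pi, ENNReal.ofReal_pow hl]

theorem volume_cube_ne_zero (c : Fin n → ℝ) {l : ℝ} (hl : 0 < l) : volume (cube c l) ≠ 0 := by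
  rw [volume_cube c hl.le]
  simpa using pow_pos hl n

theorem volume_cube_ne_top (c : Fin n → ℝ) (l : ℝ) : volume (cube c l) ≠ ∞ :=
  isCompact_Icc.measure_lt_top.ne

theorem measurableSet_cube (c : Fin n → ℝ) (l : ℝ) : MeasurableSet (cube c l) := measurableSet_Icc

theorem volume_closedBall_three_mul (x : Fin n → ℝ) {r : ℝ} (hr : 0 ≤ r) :
    volume (closedBall x (3 * r)) = 3 ^ n * volume (closedBall x r) := by
  rw [Real.volume_pi_closedBall _ (by positivity), Real.volume_pi_closedBall _ hr,
    ← ENNReal.ofReal_ofNat, ← ENNReal.ofReal_pow (by norm_num),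
    ← ENNReal.ofReal_mul (by positivity), Fintype.card_fin, ← mul_pow]
  congr 2
  ring

/-- An average over a cube is dominated by the centred maximal function at any of its points. -/
theorem laverage_cube_le_centeredMaximal (f : (Fin n → ℝ) → ℝ≥0∞) {c : Fin n → ℝ} {l : ℝ}
    (hl : 0 < l) {x : Fin n → ℝ} (hx : x ∈ cube c l) :
    ⨍⁻ y in cube c l, f y ∂volume ≤ 4 ^ n * centeredMaximal volume f x := by
  -- the radius `l` itself need not be rational
  obtain ⟨r, hlr, hrl⟩ := exists_rat_btwn (show l < 2 * l by linarith)
  have hr : (0 : ℝ) < r := hl.trans hlr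
  rw [setLAverage_eq, ENNReal.div_le_iff (volume_cube_ne_zero c hl) (volume_cube_ne_top c l)]
  have h := div_measure_closedBall_le_centeredMaximal volume f x (r := r) (by exact_mod_cast hr)
  rw [ENNReal.div_le_iff (measure_closedBall_pos _ _ hr).ne' measure_closedBall_lt_top.ne] at h
  have hvol : volume (closedBall x r) ≤ 4 ^ n * volume (cube c l) := by
    rw [Real.volume_pi_closedBall _ hr.le, volume_cube c hl.le, ← ENNReal.ofReal_ofNat,
      ← ENNReal.ofReal_pow (by norm_num), ← ENNReal.ofReal_mul (by positivity), Fintype.card_fin,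
      ← mul_pow]
    exact ENNReal.ofReal_le_ofReal (pow_le_pow_left₀ (by positivity) (by linarith) n)
  calc ∫⁻ y in cube c l, f y ≤ ∫⁻ y in closedBall x r, f y :=
        lintegral_mono_set
          ((cube_subset_closedBall hx hl.le).trans (closedBall_subset_closedBall hlr.le))
    _ ≤ centeredMaximal volume f x * volume (closedBall x r) := h
    _ ≤ centeredMaximal volume f x * (4 ^ n * volume (cube c l)) := by gcongr
    _ = 4 ^ n * centeredMaximal volume f x * volume (cube c l) := by ring

end Cubes

/-! ### Muckenhoupt's theorem -/

section Muckenhoupt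

open Metric Set

variable {n : ℕ} {p : ℝ} {w : (Fin n → ℝ) → ℝ≥0∞}

/-- The dual weight `w^{-1/(p-1)}` of an `A_p` weight `w`. -/
noncomputable def dualWeight (p : ℝ) (w : (Fin n → ℝ) → ℝ≥0∞) (x : Fin n → ℝ) : ℝ≥0∞ :=
  w x ^ (-(1 / (p - 1)))

theorem measurable_dualWeight (hw : Measurable w) : Measurable (dualWeight p w) := hw.pow_const _

theorem dualWeight_ne_zero (hp : 1 < p) {x : Fin n → ℝ} (ht : w x ≠ ∞) : dualWeight p w x ≠ 0 := by
  simp [dualWeight, ENNReal.rpow_eq_zero_iff, ht, hp.le]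

theorem dualWeight_ne_top (hp : 1 < p) {x : Fin n → ℝ} (h0 : w x ≠ 0) : dualWeight p w x ≠ ∞ := by
  simp [dualWeight, ENNReal.rpow_eq_top_iff, h0, hp.le]

theorem apConst_congr_ae {v : (Fin n → ℝ) → ℝ≥0∞} (h : w =ᵐ[volume] v) :
    apConst p w = apConst p v := by
  have h' : ∀ s, ⨍⁻ x in s, w x ∂volume = ⨍⁻ x in s, v x ∂volume := fun s =>
    laverage_congr (ae_restrict_of_ae h)
  have h'' : ∀ s, ⨍⁻ x in s, (w x) ^ (-(1 / (p - 1))) ∂volume =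
      ⨍⁻ x in s, (v x) ^ (-(1 / (p - 1))) ∂volume := fun s =>
    laverage_congr (ae_restrict_of_ae (h.fun_comp (· ^ (-(1 / (p - 1))))))
  simp only [apConst, h', h'']

theorem le_apConst (p : ℝ) (w : (Fin n → ℝ) → ℝ≥0∞) (c : Fin n → ℝ) {l : ℝ} (hl : 0 < l) :
    (⨍⁻ x in cube c l, w x ∂volume) *
      (⨍⁻ x in cube c l, (w x) ^ (-(1 / (p - 1))) ∂volume) ^ (p - 1) ≤ apConst p w :=
  le_iSup_of_le c (le_iSup₂_of_le l hl le_rfl)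

theorem apConst_dualWeight_le (hp : 1 < p) (w : (Fin n → ℝ) → ℝ≥0∞) :
    apConst p.conjExponent (dualWeight p w) ≤ apConst p w ^ (1 / (p - 1)) := by
  have hp1 : 0 < p - 1 := sub_pos.2 hp
  have hq : p.conjExponent - 1 = 1 / (p - 1) := by
    rw [Real.conjExponent]; field_simp; ring
  refine iSup_le fun c => iSup₂_le fun l hl => ?_
  have h := ENNReal.rpow_le_rpow (le_apConst p w c hl) (one_div_pos.2 hp1).le
  rw [ENNReal.mul_rpow_of_nonneg _ _ (one_div_pos.2 hp1).le, ← ENNReal.rpow_mul,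
    mul_one_div_cancel hp1.ne', ENNReal.rpow_one, mul_comm] at h
  rw [hq]
  have hw : ∀ x, dualWeight p w x ^ (-(1 / (1 / (p - 1)))) = w x := by
    intro x
    rw [dualWeight, ← ENNReal.rpow_mul]
    convert ENNReal.rpow_one _ using 2
    field_simp
  simp only [hw]
  exact h

theorem lintegral_mul_lintegral_dualWeight_le (hp : 1 < p) (w : (Fin n → ℝ) → ℝ≥0∞)
    (x : Fin n → ℝ) {r : ℝ} (hr : 0 < r) :
    (∫⁻ y in closedBall x r, w y) * (∫⁻ y in closedBall x r, dualWeight p w y) ^ (p - 1) ≤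
      apConst p w * volume (closedBall x r) ^ p := by
  have hp1 : 0 < p - 1 := sub_pos.2 hp
  have hV0 := (measure_closedBall_pos volume x hr).ne'
  have hVt : volume (closedBall x r) ≠ ∞ := measure_closedBall_lt_top.ne
  have h := le_apConst p w (fun i => x i - r) (mul_pos two_pos hr)
  rw [← closedBall_eq_cube x hr.le, setLAverage_eq, setLAverage_eq,
    ENNReal.div_rpow_of_nonneg _ _ hp1.le] at h
  set V := volume (closedBall x r)
  have hVp : V ^ p = V * V ^ (p - 1) := by
    conv_rhs => enter [1]; rw [← ENNReal.rpow_one V]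
    rw [← ENNReal.rpow_add _ _ hV0 hVt, add_sub_cancel]
  have hV0' : V ^ (p - 1) ≠ 0 := by simp [ENNReal.rpow_eq_zero_iff, hV0, hp.le]
  have hVt' : V ^ (p - 1) ≠ ∞ := by simp [hVt, hp.le]
  rw [div_eq_mul_inv, div_eq_mul_inv, mul_mul_mul_comm, ← ENNReal.mul_inv (by simp [hV0])
    (by simp [hVt]), ← hVp, ← div_eq_mul_inv, ENNReal.div_le_iff] at h
  · exact h
  · rw [hVp]; exact mul_ne_zero hV0 hV0'
  · rw [hVp]; exact ENNReal.mul_ne_top hVt hVt'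

theorem lintegral_closedBall_ne_zero (h0 : ∀ x, w x ≠ 0) (hw : Measurable w) (x : Fin n → ℝ)
    {r : ℝ} (hr : 0 < r) : ∫⁻ y in closedBall x r, w y ≠ 0 := by
  rw [Ne, lintegral_eq_zero_iff hw]
  intro h
  have : ∀ᵐ y ∂(volume.restrict (closedBall x r)), False := by
    filter_upwards [h] with y hy using h0 y hy
  rw [Filter.eventually_false_iff_eq_bot, ae_eq_bot, Measure.restrict_eq_zero] at this
  exact (measure_closedBall_pos volume x hr).ne' this

theorem lintegral_closedBall_ne_top (hp : 1 < p) (hw : Measurable w) (h0 : ∀ x, w x ≠ 0)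
    (ht : ∀ x, w x ≠ ∞) (hA : apConst p w ≠ ∞) (x : Fin n → ℝ) {r : ℝ} (hr : 0 < r) :
    ∫⁻ y in closedBall x r, w y ≠ ∞ ∧ ∫⁻ y in closedBall x r, dualWeight p w y ≠ ∞ := by
  have hp1 : 0 < p - 1 := sub_pos.2 hp
  have h := lintegral_mul_lintegral_dualWeight_le hp w x hr
  have hw0 := lintegral_closedBall_ne_zero h0 hw x hr
  have hs0 := lintegral_closedBall_ne_zero (fun x => dualWeight_ne_zero hp (ht x))
    (measurable_dualWeight (p := p) hw) x hr
  have hfin : apConst p w * volume (closedBall x r) ^ p ≠ ∞ :=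
    ENNReal.mul_ne_top hA (ENNReal.rpow_ne_top_of_nonneg (by linarith)
      measure_closedBall_lt_top.ne)
  have := ne_top_of_le_ne_top hfin h
  constructor
  · intro h1
    rw [h1, ENNReal.top_mul] at this
    · exact this rfl
    · simp [ENNReal.rpow_eq_zero_iff, hs0, hp.le]
  · intro h1
    rw [h1, ENNReal.top_rpow_of_pos hp1, ENNReal.mul_top hw0] at this
    exact this rfl

/-- Lerner's pointwise estimate: the unweighted centred maximal function is dominated by the
composition of the maximal functions of the measures `w dx` and `σ dx`, where `σ` is the dual
weight. -/
theorem centeredMaximal_rpow_le (hp : 1 < p) (hw : Measurable w) (h0 : ∀ x, w x ≠ 0)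
    (ht : ∀ x, w x ≠ ∞) (hA : apConst p w ≠ ∞) {f : (Fin n → ℝ) → ℝ≥0∞} (hf : Measurable f)
    (x : Fin n → ℝ) :
    centeredMaximal volume f x ^ (p - 1) ≤ apConst p w * (3 ^ n) ^ p *
      centeredMaximal (volume.withDensity w)
        (fun y => centeredMaximal (volume.withDensity (dualWeight p w))
          (fun z => f z / dualWeight p w z) y ^ (p - 1) / w y) x := by
  have hp1 : 0 < p - 1 := sub_pos.2 hp
  set σ := dualWeight p w with hσ
  have hσm : Measurable σ := measurable_dualWeight hw
  have hσ0 : ∀ x, σ x ≠ 0 := fun x => dualWeight_ne_zero hp (ht x)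
  have hσt : ∀ x, σ x ≠ ∞ := fun x => dualWeight_ne_top hp (h0 x)
  have hfσm : Measurable fun z => f z / σ z := hf.div hσm
  set g := centeredMaximal (volume.withDensity σ) (fun z => f z / σ z) with hg
  have hgm : Measurable g := measurable_centeredMaximal _ hfσm
  set G := fun y => g y ^ (p - 1) / w y with hG
  have hGm : Measurable G := (hgm.pow_const _).div hw
  have key : ∀ r : ℚ, 0 < r → ((∫⁻ y in closedBall x r, f y) / volume (closedBall x r)) ^ (p - 1) ≤
      apConst p w * (3 ^ n) ^ p * centeredMaximal (volume.withDensity w) G x := by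
    intro r hr
    have hr' : (0 : ℝ) < r := by exact_mod_cast hr
    set V := volume (closedBall x (r : ℝ)) with hV
    have hV0 : V ≠ 0 := (measure_closedBall_pos volume x hr').ne'
    have hVt : V ≠ ∞ := measure_closedBall_lt_top.ne
    set I := ∫⁻ y in closedBall x (r : ℝ), f y
    set S := ∫⁻ y in closedBall x (3 * r : ℝ), σ y
    have h1 : ∀ y ∈ closedBall x (r : ℝ), I ≤ g y * S := by
      intro y hy
      rw [mem_closedBall] at hy
      have hsub1 : closedBall x (r : ℝ) ⊆ closedBall y (2 * r : ℝ) :=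
        closedBall_subset_closedBall' (by rw [dist_comm]; linarith)
      have hsub2 : closedBall y (2 * r : ℝ) ⊆ closedBall x (3 * r : ℝ) :=
        closedBall_subset_closedBall' (by linarith)
      have hS := div_measure_closedBall_le_centeredMaximal (volume.withDensity σ)
        (fun z => f z / σ z) y (r := 2 * r) (by positivity)
      push_cast at hS
      rw [withDensity_apply _ measurableSet_closedBall, ENNReal.div_le_iff
        (lintegral_closedBall_ne_zero hσ0 hσm y (by positivity))
        (lintegral_closedBall_ne_top hp hw h0 ht hA y (by positivity)).2,
        setLIntegral_withDensity_eq_setLIntegral_mul _ hσm hfσm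
          measurableSet_closedBall] at hS
      have hfσ : (σ * fun z => f z / σ z) = f := by
        funext z
        exact ENNReal.mul_div_cancel (hσ0 z) (hσt z)
      rw [hfσ] at hS
      calc I ≤ ∫⁻ z in closedBall y (2 * r : ℝ), f z := lintegral_mono_set hsub1
        _ ≤ g y * ∫⁻ z in closedBall y (2 * r : ℝ), σ z := hS
        _ ≤ g y * S := by gcongr; exact lintegral_mono_set hsub2
    have h2 : I ^ (p - 1) * V ≤ S ^ (p - 1) * ∫⁻ y in closedBall x (r : ℝ), g y ^ (p - 1) := by
      rw [hV, ← setLIntegral_const, ← lintegral_const_mul _ (hgm.pow_const _)]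
      refine setLIntegral_mono' measurableSet_closedBall fun y hy => ?_
      rw [← ENNReal.mul_rpow_of_nonneg _ _ hp1.le, mul_comm]
      exact ENNReal.rpow_le_rpow (h1 y hy) hp1.le
    have h3 : ∫⁻ y in closedBall x (r : ℝ), g y ^ (p - 1) ≤
        centeredMaximal (volume.withDensity w) G x * ∫⁻ y in closedBall x (r : ℝ), w y := by
      have hS := div_measure_closedBall_le_centeredMaximal (volume.withDensity w) G x hr
      rw [withDensity_apply _ measurableSet_closedBall, ENNReal.div_le_iff
        (lintegral_closedBall_ne_zero h0 hw x hr')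
        (lintegral_closedBall_ne_top hp hw h0 ht hA x hr').1,
        setLIntegral_withDensity_eq_setLIntegral_mul _ hw hGm measurableSet_closedBall] at hS
      have hGw : w * G = fun y => g y ^ (p - 1) := by
        funext y
        exact ENNReal.mul_div_cancel (h0 y) (ht y)
      rwa [hGw] at hS
    have h4 := lintegral_mul_lintegral_dualWeight_le hp w x (r := 3 * r) (by positivity)
    rw [volume_closedBall_three_mul x hr'.le, ENNReal.mul_rpow_of_nonneg _ _ (by linarith)] at h4
    have hVp : V ^ p = V * V ^ (p - 1) := by
      conv_rhs => enter [1]; rw [← ENNReal.rpow_one V]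
      rw [← ENNReal.rpow_add _ _ hV0 hVt, add_sub_cancel]
    have hV0' : V ^ (p - 1) ≠ 0 := by simp [ENNReal.rpow_eq_zero_iff, hV0, hp.le]
    have hVt' : V ^ (p - 1) ≠ ∞ := by simp [hVt, hp.le]
    rw [ENNReal.div_rpow_of_nonneg _ _ hp1.le, ENNReal.div_le_iff hV0' hVt',
      ← ENNReal.mul_le_mul_iff_left hV0 hVt]
    calc I ^ (p - 1) * V
        ≤ S ^ (p - 1) * (centeredMaximal (volume.withDensity w) G x *
            ∫⁻ y in closedBall x (3 * r : ℝ), w y) := by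
          refine h2.trans ?_
          gcongr
          refine h3.trans ?_
          gcongr
          linarith
      _ = (∫⁻ y in closedBall x (3 * r : ℝ), w y) * S ^ (p - 1) *
            centeredMaximal (volume.withDensity w) G x := by ring
      _ ≤ apConst p w * ((3 ^ n) ^ p * V ^ p) *
            centeredMaximal (volume.withDensity w) G x := by gcongr
      _ = _ := by rw [hVp]; ring
  have hinv : ∀ a b : ℝ≥0∞, a ^ (p - 1) ≤ b ↔ a ≤ b ^ (p - 1)⁻¹ := fun a b =>
    (ENNReal.le_rpow_inv_iff hp1).symm
  rw [hinv]
  exact iSup₂_le fun r hr => (hinv _ _).1 (key r hr)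

/-- Muckenhoupt's theorem: the maximal operator is bounded on `L^p(w)` for `w ∈ A_p`, with a bound
that depends on `w` only through its `A_p` constant. -/
theorem lintegral_centeredMaximal_rpow_mul_le (n : ℕ) (hp : 1 < p) :
    ∃ C : ℝ≥0, ∀ w : (Fin n → ℝ) → ℝ≥0∞, Measurable w → (∀ x, w x ≠ 0) → (∀ x, w x ≠ ∞) →
      apConst p w ≠ ∞ → ∀ f : (Fin n → ℝ) → ℝ≥0∞, Measurable f →
        ∫⁻ x, centeredMaximal volume f x ^ p * w x ≤
          C * apConst p w ^ p.conjExponent * ∫⁻ x, f x ^ p * w x := by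
  have hp0 : 0 < p := by linarith
  have hp1 : 0 < p - 1 := sub_pos.2 hp
  have hpq : p.HolderConjugate p.conjExponent := Real.HolderConjugate.conjExponent hp
  have hq : 1 < p.conjExponent := hpq.symm.lt
  have hqp : (p - 1) * p.conjExponent = p := by rw [Real.conjExponent]; field_simp
  obtain ⟨C₁, hC₁⟩ := lintegral_centeredMaximal_rpow_le (Fin n → ℝ) hp
  obtain ⟨C₂, hC₂⟩ := lintegral_centeredMaximal_rpow_le (Fin n → ℝ) hq
  refine ⟨((3 ^ n) ^ p) ^ p.conjExponent * C₂ * C₁, fun w hw h0 ht hA f hf => ?_⟩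
  set q := p.conjExponent with hqdef
  set σ := dualWeight p w with hσ
  have hσm : Measurable σ := measurable_dualWeight hw
  have hσ0 : ∀ x, σ x ≠ 0 := fun x => dualWeight_ne_zero hp (ht x)
  have hσt : ∀ x, σ x ≠ ∞ := fun x => dualWeight_ne_top hp (h0 x)
  have hfσm : Measurable fun z => f z / σ z := hf.div hσm
  set g := centeredMaximal (volume.withDensity σ) (fun z => f z / σ z) with hg
  have hgm : Measurable g := measurable_centeredMaximal _ hfσm
  set G := fun y => g y ^ (p - 1) / w y with hG
  have hGm : Measurable G := (hgm.pow_const _).div hw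
  have hMG : Measurable (centeredMaximal (volume.withDensity w) G) :=
    measurable_centeredMaximal _ hGm
  have e1 : ∀ x, G x ^ q * w x = g x ^ p * σ x := by
    intro x
    have : σ x = (w x ^ q)⁻¹ * w x := by
      conv_rhs => rw [← ENNReal.rpow_neg]; enter [2]; rw [← ENNReal.rpow_one (w x)]
      rw [← ENNReal.rpow_add _ _ (h0 x) (ht x), hσ, dualWeight, hqdef, Real.conjExponent]
      congr 1
      field_simp
      ring
    rw [this, ENNReal.div_rpow_of_nonneg _ _ (by linarith), ← ENNReal.rpow_mul, hqp, div_eq_mul_inv,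
      mul_assoc]
  have e2 : ∀ x, (f x / σ x) ^ p * σ x = f x ^ p * w x := by
    intro x
    have : w x = (σ x ^ p)⁻¹ * σ x := by
      conv_rhs => rw [← ENNReal.rpow_neg]; enter [2]; rw [← ENNReal.rpow_one (σ x)]
      rw [← ENNReal.rpow_add _ _ (hσ0 x) (hσt x), hσ, dualWeight, ← ENNReal.rpow_mul]
      symm
      convert ENNReal.rpow_one _ using 2
      field_simp
      ring
    rw [this, ENNReal.div_rpow_of_nonneg _ _ hp0.le, div_eq_mul_inv, mul_assoc]
  have wd : ∀ {v F : (Fin n → ℝ) → ℝ≥0∞}, Measurable v → Measurable F →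
      ∫⁻ x, F x ∂(volume.withDensity v) = ∫⁻ x, F x * v x := by
    intro v F hv hF
    rw [lintegral_withDensity_eq_lintegral_mul _ hv hF]
    exact lintegral_congr fun x => mul_comm _ _
  calc ∫⁻ x, centeredMaximal volume f x ^ p * w x
      ≤ ∫⁻ x, (apConst p w * (3 ^ n) ^ p) ^ q *
          (centeredMaximal (volume.withDensity w) G x ^ q * w x) := by
        refine lintegral_mono fun x => ?_
        rw [← mul_assoc, ← ENNReal.mul_rpow_of_nonneg _ _ (by linarith : 0 ≤ q), ← hqp,
          ENNReal.rpow_mul]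
        gcongr
        rw [hqp]
        exact centeredMaximal_rpow_le hp hw h0 ht hA hf x
    _ = (apConst p w * (3 ^ n) ^ p) ^ q *
          ∫⁻ x, centeredMaximal (volume.withDensity w) G x ^ q ∂(volume.withDensity w) := by
        rw [wd hw (hMG.pow_const _)]
        exact lintegral_const_mul _ ((hMG.pow_const _).mul hw)
    _ ≤ (apConst p w * (3 ^ n) ^ p) ^ q * (C₂ * ∫⁻ x, G x ^ q ∂(volume.withDensity w)) := by
        gcongr
        exact hC₂ _ G hGm
    _ = (apConst p w * (3 ^ n) ^ p) ^ q * (C₂ * ∫⁻ x, g x ^ p ∂(volume.withDensity σ)) := by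
        rw [wd hw (hGm.pow_const _), wd hσm (hgm.pow_const _)]
        simp only [e1]
    _ ≤ (apConst p w * (3 ^ n) ^ p) ^ q * (C₂ *
          (C₁ * ∫⁻ x, (f x / σ x) ^ p ∂(volume.withDensity σ))) := by
        gcongr
        exact hC₁ _ _ hfσm
    _ = (apConst p w * (3 ^ n) ^ p) ^ q * (C₂ * (C₁ * ∫⁻ x, f x ^ p * w x)) := by
        rw [wd hσm (hfσm.pow_const _)]
        simp only [e2]
    _ = _ := by
        rw [ENNReal.mul_rpow_of_nonneg _ _ (by linarith : 0 ≤ q)]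
        push_cast [ENNReal.coe_rpow_of_nonneg _ hp0.le,
          ENNReal.coe_rpow_of_nonneg _ (by linarith : 0 ≤ q)]
        ring

end Muckenhoupt

/-! ### The Rubio de Francia algorithm -/

section RubioDeFrancia

open Metric Set

theorem ENNReal.tsum_inv_two_pow_succ : ∑' k : ℕ, (2⁻¹ : ℝ≥0∞) ^ (k + 1) = 1 := by
  rw [ENNReal.tsum_geometric_add_one, ENNReal.one_sub_inv_two, inv_inv]
  exact ENNReal.inv_mul_cancel (by simp) (by simp)

/-- Jensen's inequality for `t ↦ t ^ p` and countably many weights of sum `1`. -/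
theorem ENNReal.rpow_tsum_mul_le {p : ℝ} (hp : 1 < p) {c : ℕ → ℝ≥0∞} (hc : ∑' k, c k = 1)
    (z : ℕ → ℝ≥0∞) : (∑' k, c k * z k) ^ p ≤ ∑' k, c k * z k ^ p := by
  have hp0 : 0 < p := by linarith
  have hpq : p.HolderConjugate p.conjExponent := Real.HolderConjugate.conjExponent hp
  have hq0 : 0 < p.conjExponent := hpq.symm.pos
  have h := ENNReal.lintegral_mul_le_Lp_mul_Lq Measure.count hpq
    (f := fun k => c k ^ (1 / p) * z k) (g := fun k => c k ^ (1 / p.conjExponent))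
    (measurable_from_nat).aemeasurable (measurable_from_nat).aemeasurable
  simp only [lintegral_count, Pi.mul_apply] at h
  have e1 : ∀ k, c k ^ (1 / p) * z k * c k ^ (1 / p.conjExponent) = c k * z k := by
    intro k
    rw [mul_right_comm, ← ENNReal.rpow_add_of_nonneg _ _ (by positivity) (by positivity),
      one_div, one_div, hpq.inv_add_inv_eq_one, ENNReal.rpow_one]
  have e2 : ∀ k, (c k ^ (1 / p) * z k) ^ p = c k * z k ^ p := by
    intro k
    rw [ENNReal.mul_rpow_of_nonneg _ _ hp0.le, ← ENNReal.rpow_mul, one_div_mul_cancel hp0.ne',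
      ENNReal.rpow_one]
  have e3 : ∀ k, (c k ^ (1 / p.conjExponent)) ^ p.conjExponent = c k := by
    intro k
    rw [← ENNReal.rpow_mul, one_div_mul_cancel hq0.ne', ENNReal.rpow_one]
  simp only [e1, e2, e3, hc, ENNReal.one_rpow, mul_one] at h
  rw [one_div] at h
  exact (ENNReal.le_rpow_inv_iff hp0).1 h

theorem lintegral_tsum_rpow_le {α : Type*} [MeasurableSpace α] {μ : Measure α} {p : ℝ} (hp : 1 < p)
    {a : ℕ → α → ℝ≥0∞} (ha : ∀ k, Measurable (a k)) {S : ℝ≥0∞}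
    (h : ∀ k, ∫⁻ x, a k x ^ p ∂μ ≤ S) :
    ∫⁻ x, (∑' k, (2⁻¹ : ℝ≥0∞) ^ (k + 1) * a k x) ^ p ∂μ ≤ S :=
  calc ∫⁻ x, (∑' k, (2⁻¹ : ℝ≥0∞) ^ (k + 1) * a k x) ^ p ∂μ
      ≤ ∫⁻ x, ∑' k, (2⁻¹ : ℝ≥0∞) ^ (k + 1) * a k x ^ p ∂μ :=
        lintegral_mono fun _ => ENNReal.rpow_tsum_mul_le hp ENNReal.tsum_inv_two_pow_succ _
    _ = ∑' k, (2⁻¹ : ℝ≥0∞) ^ (k + 1) * ∫⁻ x, a k x ^ p ∂μ := by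
        rw [lintegral_tsum fun k => (((ha k).pow_const p).const_mul _).aemeasurable]
        exact tsum_congr fun k => lintegral_const_mul _ ((ha k).pow_const p)
    _ ≤ ∑' k, (2⁻¹ : ℝ≥0∞) ^ (k + 1) * S := by
        gcongr with k
        exact h k
    _ = S := by rw [ENNReal.tsum_mul_right, ENNReal.tsum_inv_two_pow_succ, one_mul]

theorem le_two_pow_mul_tsum (z : ℕ → ℝ≥0∞) (k : ℕ) :
    z k ≤ 2 ^ (k + 1) * ∑' j, (2⁻¹ : ℝ≥0∞) ^ (j + 1) * z j := by
  calc z k = 2 ^ (k + 1) * ((2⁻¹ : ℝ≥0∞) ^ (k + 1) * z k) := by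
        rw [← mul_assoc, ← mul_pow, ENNReal.mul_inv_cancel (by simp) (by simp), one_pow, one_mul]
    _ ≤ _ := by gcongr; exact ENNReal.le_tsum (f := fun j => (2⁻¹ : ℝ≥0∞) ^ (j + 1) * z j) k

/-- The Rubio de Francia algorithm: if the maximal operator `M` is bounded on `L^p(ν)` with norm at
most `B`, then every `h` has a majorant `2 a` with `M a ≤ 2 B a` whose norm in `L^p(ν)` is at most
twice that of `h`. It is given by `a = ∑ k, 2 ^ (-(k + 1)) B ^ (-k) M ^ k h`. -/
theorem exists_majorant_centeredMaximal_le {n : ℕ} {p : ℝ} (hp : 1 < p)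
    {ν : Measure (Fin n → ℝ)} {B : ℝ≥0∞} (hB0 : B ≠ 0) (hBt : B ≠ ∞)
    (hB : ∀ f : (Fin n → ℝ) → ℝ≥0∞, Measurable f →
      ∫⁻ x, centeredMaximal volume f x ^ p ∂ν ≤ B ^ p * ∫⁻ x, f x ^ p ∂ν)
    {h : (Fin n → ℝ) → ℝ≥0∞} (hh : Measurable h) :
    ∃ a : (Fin n → ℝ) → ℝ≥0∞, Measurable a ∧ (∀ x, h x ≤ 2 * a x) ∧
      (∀ x, centeredMaximal volume a x ≤ 2 * B * a x) ∧
      ∫⁻ x, a x ^ p ∂ν ≤ ∫⁻ x, h x ^ p ∂ν := by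
  have hp0 : 0 < p := by linarith
  set M : ((Fin n → ℝ) → ℝ≥0∞) → ((Fin n → ℝ) → ℝ≥0∞) := centeredMaximal volume with hM
  have hMm : ∀ k, Measurable (M^[k] h) := by
    intro k
    induction k with
    | zero => exact hh
    | succ k ih =>
      rw [Function.iterate_succ_apply']
      exact measurable_centeredMaximal _ ih
  set z : ℕ → (Fin n → ℝ) → ℝ≥0∞ := fun k x => B⁻¹ ^ k * M^[k] h x with hz
  have hzm : ∀ k, Measurable (z k) := fun k => (hMm k).const_mul _
  have hzB : ∀ k, ∫⁻ x, z k x ^ p ∂ν ≤ ∫⁻ x, h x ^ p ∂ν := by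
    intro k
    induction k with
    | zero => simp [hz]
    | succ k ih =>
      refine le_trans ?_ ih
      have e : ∀ x, z (k + 1) x = B⁻¹ * M (z k) x := by
        intro x
        rw [hM, hz, centeredMaximal_const_mul (hMm k)]
        simp only [Function.iterate_succ_apply', hM]
        ring
      calc ∫⁻ x, z (k + 1) x ^ p ∂ν = (B⁻¹) ^ p * ∫⁻ x, M (z k) x ^ p ∂ν := by
            simp only [e, ENNReal.mul_rpow_of_nonneg _ _ hp0.le]
            exact lintegral_const_mul _ ((measurable_centeredMaximal _ (hzm k)).pow_const p)
        _ ≤ (B⁻¹) ^ p * (B ^ p * ∫⁻ x, z k x ^ p ∂ν) := by gcongr; exact hB _ (hzm k)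
        _ = _ := by
            rw [← mul_assoc, ← ENNReal.mul_rpow_of_nonneg _ _ hp0.le,
              ENNReal.inv_mul_cancel hB0 hBt, ENNReal.one_rpow, one_mul]
  refine ⟨fun x => ∑' k, (2⁻¹ : ℝ≥0∞) ^ (k + 1) * z k x,
    Measurable.tsum fun k => (hzm k).const_mul _, fun x => ?_, fun x => ?_,
    lintegral_tsum_rpow_le hp hzm hzB⟩
  · simpa [hz] using le_two_pow_mul_tsum (fun k => z k x) 0
  · refine (centeredMaximal_tsum_le (fun k => (hzm k).const_mul _) x).trans ?_
    rw [← ENNReal.tsum_mul_left]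
    calc ∑' k, centeredMaximal volume (fun y => (2⁻¹ : ℝ≥0∞) ^ (k + 1) * z k y) x
        = ∑' k, 2 * B * ((2⁻¹ : ℝ≥0∞) ^ (k + 1 + 1) * z (k + 1) x) := by
          refine tsum_congr fun k => ?_
          rw [centeredMaximal_const_mul (hzm k), hz, centeredMaximal_const_mul (hMm k)]
          simp only [Function.iterate_succ_apply', hM]
          rw [pow_succ 2⁻¹ (k + 1), pow_succ B⁻¹ k]
          have h2 : (2 : ℝ≥0∞) * 2⁻¹ = 1 := ENNReal.mul_inv_cancel (by simp) (by simp)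
          have hBB : B * B⁻¹ = 1 := ENNReal.mul_inv_cancel hB0 hBt
          calc _ = (2 * 2⁻¹) * (B * B⁻¹) * ((2⁻¹ : ℝ≥0∞) ^ (k + 1) *
                (B⁻¹ ^ k * centeredMaximal volume ((centeredMaximal volume)^[k] h) x)) := by
                rw [h2, hBB, one_mul, one_mul]
            _ = _ := by ring
      _ ≤ ∑' k, 2 * B * ((2⁻¹ : ℝ≥0∞) ^ (k + 1) * z k x) :=
          ENNReal.tsum_comp_le_tsum_of_injective (add_left_injective 1)
            fun k => 2 * B * ((2⁻¹ : ℝ≥0∞) ^ (k + 1) * z k x)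

theorem centeredMaximal_volume_ne_zero {n : ℕ} {f : (Fin n → ℝ) → ℝ≥0∞} (hf : Measurable f)
    (h : ¬ f =ᵐ[volume] 0) (x : Fin n → ℝ) : centeredMaximal volume f x ≠ 0 := by
  intro h0
  refine h ?_
  have hU : ⋃ k : ℕ, closedBall x ((k : ℝ) + 1) = univ := by
    refine eq_univ_of_forall fun y => ?_
    obtain ⟨k, hk⟩ := exists_nat_ge (dist y x)
    exact mem_iUnion.2 ⟨k, by rw [mem_closedBall]; linarith⟩
  have key : ∀ k : ℕ, f =ᵐ[volume.restrict (closedBall x ((k : ℝ) + 1))] 0 := by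
    intro k
    have hk := div_measure_closedBall_le_centeredMaximal volume f x (r := (k : ℚ) + 1)
      (by positivity)
    rw [h0, nonpos_iff_eq_zero, ENNReal.div_eq_zero_iff] at hk
    push_cast at hk
    rcases hk with hk | hk
    · exact (lintegral_eq_zero_iff hf).1 hk
    · exact absurd hk measure_closedBall_lt_top.ne
  have := (ae_restrict_iUnion_iff (μ := volume)
    (fun k : ℕ => closedBall x ((k : ℝ) + 1)) (fun y => f y = 0)).2 key
  rwa [hU, Measure.restrict_univ] at this

end RubioDeFrancia

/-! ### Weights of the form `a ^ (1 - p) * b` -/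

section Factorization

open Metric Set

variable {n : ℕ} {p : ℝ}

/-- The `A_1` condition with constant `K`: on every cube the average of `a` is at most `K` times each
value of `a`. -/
def IsA1 (K : ℝ≥0∞) (a : (Fin n → ℝ) → ℝ≥0∞) : Prop :=
  ∀ (c : Fin n → ℝ) (l : ℝ), 0 < l → ∀ x ∈ cube c l, ⨍⁻ y in cube c l, a y ∂volume ≤ K * a x

theorem IsA1.mono {K L : ℝ≥0∞} (hKL : K ≤ L) {a : (Fin n → ℝ) → ℝ≥0∞} (h : IsA1 K a) : IsA1 L a :=
  fun c l hl x hx => (h c l hl x hx).trans (by gcongr)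

theorem isA1_of_centeredMaximal_le {K : ℝ≥0∞} {a : (Fin n → ℝ) → ℝ≥0∞}
    (h : ∀ x, centeredMaximal volume a x ≤ K * a x) : IsA1 (4 ^ n * K) a := by
  intro c l hl x hx
  refine (laverage_cube_le_centeredMaximal a hl hx).trans ?_
  rw [mul_assoc]
  gcongr
  exact h x

theorem laverage_cube_ne_zero {a : (Fin n → ℝ) → ℝ≥0∞} (c : Fin n → ℝ) {l : ℝ} (hl : 0 < l)
    (ha : AEMeasurable a (volume.restrict (cube c l)))
    (h0 : ∀ᵐ x ∂(volume.restrict (cube c l)), a x ≠ 0) :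
    ⨍⁻ y in cube c l, a y ∂volume ≠ 0 := by
  rw [setLAverage_eq]
  refine (ENNReal.div_pos ?_ (volume_cube_ne_top c l)).ne'
  rw [Ne, lintegral_eq_zero_iff' ha]
  intro h
  have : ∀ᵐ y ∂(volume.restrict (cube c l)), False := by
    filter_upwards [h, h0] with y hy hy' using hy' hy
  rw [Filter.eventually_false_iff_eq_bot, ae_eq_bot, Measure.restrict_eq_zero] at this
  exact volume_cube_ne_zero c hl this

theorem IsA1.laverage_ne_top {K : ℝ≥0∞} (hK : K ≠ ∞) {a : (Fin n → ℝ) → ℝ≥0∞} (h : IsA1 K a)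
    (ht : ∀ᵐ x ∂volume, a x ≠ ∞) (c : Fin n → ℝ) {l : ℝ} (hl : 0 < l) :
    ⨍⁻ y in cube c l, a y ∂volume ≠ ∞ := by
  have hne : (ae (volume.restrict (cube c l))).NeBot := by
    rw [ae_neBot, Ne, Measure.restrict_eq_zero]
    exact volume_cube_ne_zero c hl
  obtain ⟨x, hx, hxt⟩ :=
    ((ae_restrict_mem (measurableSet_cube c l)).and (ae_restrict_of_ae ht)).exists
  exact ne_top_of_le_ne_top (ENNReal.mul_ne_top hK hxt) (h c l hl x hx)

theorem inv_le_mul_inv_of_le_mul {α K y : ℝ≥0∞} (hα0 : α ≠ 0) (hαt : α ≠ ∞) (hy : y ≠ 0)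
    (h : α ≤ K * y) : y⁻¹ ≤ K * α⁻¹ := by
  by_cases hyt : y = ∞
  · simp [hyt]
  calc y⁻¹ = α * (α⁻¹ * y⁻¹) := by
        rw [← mul_assoc, ENNReal.mul_inv_cancel hα0 hαt, one_mul]
    _ ≤ K * y * (α⁻¹ * y⁻¹) := by gcongr
    _ = K * α⁻¹ * (y * y⁻¹) := by ring
    _ = K * α⁻¹ := by rw [ENNReal.mul_inv_cancel hy hyt, mul_one]

/-- The easy half of the factorization theorem: `a ^ (1 - p) * b` is an `A_p` weight if `a` and `b`
satisfy the `A_1` condition. -/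
theorem IsA1.isApWeight (hp : 1 < p) {K : ℝ≥0∞} (hK : K ≠ ∞) {a b : (Fin n → ℝ) → ℝ≥0∞}
    (ha : IsA1 K a) (hb : IsA1 K b) (ham : Measurable a) (hbm : Measurable b)
    (ha0 : ∀ x, a x ≠ 0) (hb0 : ∀ x, b x ≠ 0)
    (hat : ∀ᵐ x ∂volume, a x ≠ ∞) (hbt : ∀ᵐ x ∂volume, b x ≠ ∞) :
    IsApWeight p (fun x => a x ^ (1 - p) * b x) ∧
      apConst p (fun x => a x ^ (1 - p) * b x) ≤ K ^ p := by
  have hp1 : 0 < p - 1 := sub_pos.2 hp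
  have hum : Measurable fun x => a x ^ (1 - p) * b x := (ham.pow_const _).mul hbm
  have havg : ∀ (c : Fin n → ℝ) (l : ℝ), 0 < l →
      ⨍⁻ x in cube c l, a x ^ (1 - p) * b x ∂volume ≤
        (K * (⨍⁻ x in cube c l, a x ∂volume)⁻¹) ^ (p - 1) * ⨍⁻ x in cube c l, b x ∂volume := by
    intro c l hl
    have hα0 := laverage_cube_ne_zero c hl ham.aemeasurable (ae_of_all _ ha0)
    have hαt := ha.laverage_ne_top hK hat c hl
    rw [setLAverage_eq, setLAverage_eq _ b, ← mul_div_assoc, ← lintegral_const_mul _ hbm]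
    refine ENNReal.div_le_div_right (setLIntegral_mono' (measurableSet_cube c l) fun x hx => ?_) _
    gcongr ?_ * _
    rw [← neg_sub, ENNReal.rpow_neg, ← ENNReal.inv_rpow]
    exact ENNReal.rpow_le_rpow
      (inv_le_mul_inv_of_le_mul hα0 hαt (ha0 x) (ha c l hl x hx)) hp1.le
  have hap : apConst p (fun x => a x ^ (1 - p) * b x) ≤ K ^ p := by
    refine iSup_le fun c => iSup₂_le fun l hl => ?_
    have hα0 := laverage_cube_ne_zero c hl ham.aemeasurable (ae_of_all _ ha0)
    have hαt := ha.laverage_ne_top hK hat c hl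
    have hβ0 := laverage_cube_ne_zero c hl hbm.aemeasurable (ae_of_all _ hb0)
    have hβt := hb.laverage_ne_top hK hbt c hl
    have h1 := havg c l hl
    have h2 : ⨍⁻ x in cube c l, (a x ^ (1 - p) * b x) ^ (-(1 / (p - 1))) ∂volume ≤
        (K * (⨍⁻ x in cube c l, b x ∂volume)⁻¹) ^ (1 / (p - 1)) *
          ⨍⁻ x in cube c l, a x ∂volume := by
      rw [setLAverage_eq, setLAverage_eq _ a, ← mul_div_assoc, ← lintegral_const_mul _ ham]
      refine ENNReal.div_le_div_right (lintegral_mono_ae ?_) _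
      filter_upwards [ae_restrict_mem (measurableSet_cube c l), ae_restrict_of_ae hat,
        ae_restrict_of_ae hbt] with x hx hax hbx
      have hpow0 : a x ^ (1 - p) ≠ 0 := (ENNReal.rpow_pos (pos_iff_ne_zero.2 (ha0 x)) hax).ne'
      have hpowt : a x ^ (1 - p) ≠ ∞ := by
        rw [← neg_sub, ENNReal.rpow_neg, ENNReal.inv_ne_top]
        exact (ENNReal.rpow_pos (pos_iff_ne_zero.2 (ha0 x)) hax).ne'
      rw [ENNReal.mul_rpow_of_ne_zero hpow0 (hb0 x), ← ENNReal.rpow_mul,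
        show (1 - p) * -(1 / (p - 1)) = 1 by field_simp; ring, ENNReal.rpow_one, mul_comm]
      gcongr
      rw [ENNReal.rpow_neg, ← ENNReal.inv_rpow]
      exact ENNReal.rpow_le_rpow
        (inv_le_mul_inv_of_le_mul hβ0 hβt (hb0 x) (hb c l hl x hx)) (by positivity)
    set α := ⨍⁻ x in cube c l, a x ∂volume
    set β := ⨍⁻ x in cube c l, b x ∂volume
    have hK0 : K ≠ 0 := by
      rintro rfl
      have := ha c l hl c ⟨le_rfl, fun i => by simp [hl.le]⟩
      rw [zero_mul] at this
      exact hα0 (nonpos_iff_eq_zero.1 this)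
    calc _ ≤ (K * α⁻¹) ^ (p - 1) * β * ((K * β⁻¹) ^ (1 / (p - 1)) * α) ^ (p - 1) := by gcongr
      _ = K ^ (p - 1) * K * ((α⁻¹ * α) ^ (p - 1)) * (β⁻¹ * β) := by
          rw [ENNReal.mul_rpow_of_nonneg _ α hp1.le, ← ENNReal.rpow_mul,
            one_div_mul_cancel hp1.ne', ENNReal.rpow_one, ENNReal.mul_rpow_of_nonneg _ _ hp1.le,
            ENNReal.mul_rpow_of_nonneg _ _ hp1.le]
          ring
      _ = K ^ p := by
          rw [ENNReal.inv_mul_cancel hα0 hαt, ENNReal.inv_mul_cancel hβ0 hβt, ENNReal.one_rpow,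
            mul_one, mul_one]
          conv_lhs => enter [2]; rw [← ENNReal.rpow_one K]
          rw [← ENNReal.rpow_add _ _ hK0 hK, sub_add_cancel]
  refine ⟨⟨hum.aemeasurable, ?_, ?_, ?_⟩, hap⟩
  · filter_upwards [hat] with x hx
    exact pos_iff_ne_zero.2 (mul_ne_zero (ENNReal.rpow_pos (pos_iff_ne_zero.2 (ha0 x)) hx).ne'
      (hb0 x))
  · intro s hs
    obtain ⟨R, hR0, hR⟩ := hs.isBounded.subset_closedBall_lt 0 0
    refine (lintegral_mono_set hR).trans_lt (lt_top_iff_ne_top.2 ?_)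
    have hl : (0 : ℝ) < 2 * R := by positivity
    rw [closedBall_eq_cube _ hR0.le]
    set c : Fin n → ℝ := fun i => (0 : Fin n → ℝ) i - R
    have hα0 := laverage_cube_ne_zero c hl ham.aemeasurable (ae_of_all _ ha0)
    have hfin : (K * (⨍⁻ x in cube c (2 * R), a x ∂volume)⁻¹) ^ (p - 1) *
        ⨍⁻ x in cube c (2 * R), b x ∂volume ≠ ∞ :=
      ENNReal.mul_ne_top (ENNReal.rpow_ne_top_of_nonneg hp1.le
        (ENNReal.mul_ne_top hK (ENNReal.inv_ne_top.2 hα0))) (hb.laverage_ne_top hK hbt c hl)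
    have h := ne_top_of_le_ne_top hfin (havg c _ hl)
    rw [setLAverage_eq] at h
    intro htop
    rw [htop, ENNReal.top_div_of_ne_top (volume_cube_ne_top _ _)] at h
    exact h rfl
  · exact hap.trans_lt (ENNReal.rpow_lt_top_of_nonneg (by linarith) hK)

end Factorization

/-! ### Extrapolation for a fixed pair of functions -/

section Extrapolation

open Metric Set

variable {n : ℕ} {p : ℝ}

theorem lintegral_withDensity_eq_lintegral_mul_density {α : Type*} [MeasurableSpace α]
    (μ : Measure α) {v f : α → ℝ≥0∞} (hv : Measurable v) (hf : AEMeasurable f μ) :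
    ∫⁻ x, f x ∂(μ.withDensity v) = ∫⁻ x, f x * v x ∂μ := by
  rw [lintegral_withDensity_eq_lintegral_mul₀ hv.aemeasurable hf]
  exact lintegral_congr fun x => mul_comm _ _

/-- The Rubio de Francia algorithm on `L^p(w)` for `w ∈ A_p`, with the `A_1` constant controlled by
the `A_p` constant of `w`. -/
theorem exists_isA1_majorant (n : ℕ) (hp : 1 < p) :
    ∃ K : ℝ≥0 → ℝ≥0, Monotone K ∧ ∀ w : (Fin n → ℝ) → ℝ≥0∞, Measurable w → (∀ x, w x ≠ 0) →
      (∀ x, w x ≠ ∞) → apConst p w ≠ ∞ → ∀ h : (Fin n → ℝ) → ℝ≥0∞, Measurable h →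
        ¬ h =ᵐ[volume] 0 → ∫⁻ x, h x ^ p * w x ≤ 1 →
          ∃ a : (Fin n → ℝ) → ℝ≥0∞, Measurable a ∧ (∀ x, h x ≤ 2 * a x) ∧
            IsA1 (K (apConst p w).toNNReal) a ∧ (∀ x, a x ≠ 0) ∧ (∀ᵐ x ∂volume, a x ≠ ∞) ∧
              ∫⁻ x, a x ^ p * w x ≤ 1 := by
  have hp0 : 0 < p := by linarith
  have hq0 : 0 < p.conjExponent := (Real.HolderConjugate.conjExponent hp).symm.pos
  obtain ⟨C, hC⟩ := lintegral_centeredMaximal_rpow_mul_le n hp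
  let B : ℝ≥0 → ℝ≥0 := fun t => (C * t ^ p.conjExponent + 1) ^ (1 / p)
  have hBmono : Monotone B := by
    intro s t hst
    simp only [B]
    gcongr
  refine ⟨fun t => 4 ^ n * (2 * B t), fun s t hst => by simp only; gcongr; exact hBmono hst,
    fun w hw h0 ht hA h hh hne hle => ?_⟩
  set t := (apConst p w).toNNReal with htdef
  have hAt : apConst p w = t := (ENNReal.coe_toNNReal hA).symm
  have hB0 : B t ≠ 0 := by
    simp only [B]
    exact (NNReal.rpow_pos (by positivity)).ne'
  have hBp : ((B t : ℝ≥0) : ℝ≥0∞) ^ p = C * (t : ℝ≥0∞) ^ p.conjExponent + 1 := by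
    simp only [B]
    rw [← ENNReal.coe_rpow_of_nonneg _ hp0.le, ← NNReal.rpow_mul, one_div_mul_cancel hp0.ne',
      NNReal.rpow_one]
    push_cast [ENNReal.coe_rpow_of_nonneg _ hq0.le]
    rfl
  obtain ⟨a, ham, hha, hMa, hint⟩ := exists_majorant_centeredMaximal_le (ν := volume.withDensity w)
    (B := B t) hp (by exact_mod_cast hB0) ENNReal.coe_ne_top (fun f hf => by
      rw [lintegral_withDensity_eq_lintegral_mul_density _ hw
          ((measurable_centeredMaximal _ hf).pow_const p).aemeasurable,
        lintegral_withDensity_eq_lintegral_mul_density _ hw (hf.pow_const p).aemeasurable, hBp]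
      refine (hC w hw h0 ht hA f hf).trans ?_
      rw [hAt]
      gcongr
      exact le_self_add) hh
  rw [lintegral_withDensity_eq_lintegral_mul_density _ hw (ham.pow_const p).aemeasurable,
    lintegral_withDensity_eq_lintegral_mul_density _ hw (hh.pow_const p).aemeasurable] at hint
  have hint1 := hint.trans hle
  refine ⟨a, ham, hha, ?_, ?_, ?_, hint1⟩
  · push_cast
    exact isA1_of_centeredMaximal_le hMa
  · have hane : ¬ a =ᵐ[volume] 0 := by
      intro ha
      refine hne ?_
      filter_upwards [ha] with x hx
      have := hha x
      rw [hx] at this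
      simpa using this
    intro x hx
    have := hMa x
    rw [hx, mul_zero] at this
    exact centeredMaximal_volume_ne_zero ham hane x (nonpos_iff_eq_zero.1 this)
  · filter_upwards [ae_lt_top ((ham.pow_const p).mul hw)
      (ne_top_of_le_ne_top ENNReal.one_ne_top hint1)] with x hx
    intro hax
    simp only [Pi.mul_apply] at hx
    rw [hax, ENNReal.top_rpow_of_pos hp0, ENNReal.top_mul (h0 x)] at hx
    exact lt_irrefl _ hx

/-- The heart of extrapolation: unit vectors `F` of `L^p(w)` and `H` of its dual produce an `A_{p₀}`
weight `u`, and one `L^{p₀}(u)` inequality for `(f, g)` controls the pairing of `g` with `H` as soon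
as `f` is dominated by a multiple of `F`. The weight is independent of `(f, g)`. -/
theorem exists_isApWeight_forall_lintegral_mul_le (n : ℕ) {p₀ : ℝ} (hp₀ : 1 < p₀) (hp : 1 < p) :
    ∃ K : ℝ≥0 → ℝ≥0, Monotone K ∧ ∀ w : (Fin n → ℝ) → ℝ≥0∞, Measurable w → (∀ x, w x ≠ 0) →
      (∀ x, w x ≠ ∞) → apConst p w ≠ ∞ →
      ∀ F H : (Fin n → ℝ) → ℝ≥0∞, Measurable F → Measurable H →
        ¬ F =ᵐ[volume] 0 → ¬ H =ᵐ[volume] 0 →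
        ∫⁻ x, F x ^ p * w x ≤ 1 → ∫⁻ x, H x ^ p.conjExponent * w x ≤ 1 →
        ∃ u : (Fin n → ℝ) → ℝ≥0∞, IsApWeight p₀ u ∧
          apConst p₀ u ≤ K (apConst p w).toNNReal ∧
          ∀ f g : (Fin n → ℝ) → ℝ≥0∞, AEMeasurable g volume → ∀ C s : ℝ≥0∞,
            (∀ᵐ x ∂volume, f x ≤ s * F x) → weightedNorm p₀ u g ≤ C * weightedNorm p₀ u f →
              ∫⁻ x, g x * H x * w x ≤ 4 * C * s := by
  have hp0 : 0 < p := by linarith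
  have hp1 : 0 < p - 1 := sub_pos.2 hp
  have hp₀0 : 0 < p₀ := by linarith
  have hpq : p.HolderConjugate p.conjExponent := Real.HolderConjugate.conjExponent hp
  have hq0 : 0 < p.conjExponent := hpq.symm.pos
  have hq : 1 < p.conjExponent := hpq.symm.lt
  obtain ⟨K₁, hK₁m, hK₁⟩ := exists_isA1_majorant n hp
  obtain ⟨K₂, hK₂m, hK₂⟩ := exists_isA1_majorant n hq
  let L : ℝ≥0 → ℝ≥0 := fun t => K₁ t + K₂ (t ^ (1 / (p - 1)))
  have hLm : Monotone L := by
    intro s t hst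
    refine add_le_add (hK₁m hst) (hK₂m ?_)
    gcongr
  refine ⟨fun t => L t ^ p₀, fun s t hst => by
    simp only
    gcongr
    exact hLm hst, fun w hw h0 ht hA F H hF hH hF0 hH0 hF1 hH1 => ?_⟩
  set t := (apConst p w).toNNReal with htdef
  have hAt : apConst p w = t := (ENNReal.coe_toNNReal hA).symm
  set q := p.conjExponent with hqdef
  set σ := dualWeight p w with hσ
  have hσm : Measurable σ := measurable_dualWeight hw
  have hσ0 : ∀ x, σ x ≠ 0 := fun x => dualWeight_ne_zero hp (ht x)
  have hσt : ∀ x, σ x ≠ ∞ := fun x => dualWeight_ne_top hp (h0 x)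
  have hσA : apConst q σ ≤ ((t ^ (1 / (p - 1)) : ℝ≥0) : ℝ≥0∞) := by
    rw [ENNReal.coe_rpow_of_nonneg _ (one_div_pos.2 hp1).le, ← hAt]
    exact apConst_dualWeight_le hp w
  have hσAt : apConst q σ ≠ ∞ := ne_top_of_le_ne_top ENNReal.coe_ne_top hσA
  obtain ⟨a, ham, hFa, haA1, ha0, hat, ha1⟩ := hK₁ w hw h0 ht hA F hF hF0 hF1
  -- the dual function is handled through `H * w`, of the same norm in `L^q(σ)`
  have hHw : ∀ x, (H x * w x) ^ q * σ x = H x ^ q * w x := by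
    intro x
    rw [ENNReal.mul_rpow_of_nonneg _ _ hq0.le, mul_assoc]
    congr 1
    rw [hσ, dualWeight, ← ENNReal.rpow_add _ _ (h0 x) (ht x)]
    convert ENNReal.rpow_one _ using 2
    rw [hqdef, Real.conjExponent]
    field_simp
    ring
  obtain ⟨b, hbm, hHb, hbA1, hb0, hbt, hb1⟩ := hK₂ σ hσm hσ0 hσt hσAt (fun x => H x * w x)
    (hH.mul hw) (fun h => hH0 (by
      filter_upwards [h] with x hx
      simpa [h0 x] using hx)) (by simpa only [hHw] using hH1)
  have hbK : K₂ (apConst q σ).toNNReal ≤ K₂ (t ^ (1 / (p - 1))) :=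
    hK₂m ((ENNReal.toNNReal_mono ENNReal.coe_ne_top hσA).trans_eq (ENNReal.toNNReal_coe _))
  have haL : IsA1 (L t : ℝ≥0∞) a := haA1.mono (by
    exact_mod_cast (le_self_add : K₁ t ≤ K₁ t + K₂ (t ^ (1 / (p - 1)))))
  have hbL : IsA1 (L t : ℝ≥0∞) b := hbA1.mono (by
    exact_mod_cast hbK.trans (le_add_self : K₂ (t ^ (1 / (p - 1))) ≤ K₁ t + _))
  obtain ⟨hu, huA⟩ := haL.isApWeight hp₀ ENNReal.coe_ne_top hbL ham hbm ha0 hb0 hat hbt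
  -- `a` and `b` pair to at most one, by Hölder's inequality
  have hab : ∫⁻ x, a x * b x ≤ 1 := by
    have h := ENNReal.lintegral_mul_le_Lp_mul_Lq volume hpq
      (f := fun x => a x * w x ^ (1 / p)) (g := fun x => b x * w x ^ (-(1 / p)))
      (ham.mul (hw.pow_const _)).aemeasurable (hbm.mul (hw.pow_const _)).aemeasurable
    have e1 : ∀ x, (a x * w x ^ (1 / p)) * (b x * w x ^ (-(1 / p))) = a x * b x := by
      intro x
      rw [mul_mul_mul_comm, ← ENNReal.rpow_add _ _ (h0 x) (ht x), add_neg_cancel,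
        ENNReal.rpow_zero, mul_one]
    have e2 : ∀ x, (a x * w x ^ (1 / p)) ^ p = a x ^ p * w x := by
      intro x
      rw [ENNReal.mul_rpow_of_nonneg _ _ hp0.le, ← ENNReal.rpow_mul, one_div_mul_cancel hp0.ne',
        ENNReal.rpow_one]
    have e3 : ∀ x, (b x * w x ^ (-(1 / p))) ^ q = b x ^ q * σ x := by
      intro x
      rw [ENNReal.mul_rpow_of_nonneg _ _ hq0.le, ← ENNReal.rpow_mul, hσ, dualWeight]
      congr 2
      rw [hqdef, Real.conjExponent]
      field_simp
    simp only [Pi.mul_apply, e1, e2, e3] at h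
    calc ∫⁻ x, a x * b x ≤ _ := h
      _ ≤ 1 ^ (1 / p) * 1 ^ (1 / q) := by gcongr
      _ = 1 := by simp
  refine ⟨_, hu, ?_, fun f g hg C s hfs hfg => ?_⟩
  · rwa [ENNReal.coe_rpow_of_nonneg _ hp₀0.le]
  have hnu : (volume.withDensity fun x => a x * b x) univ ≤ 1 := by
    rw [withDensity_apply _ MeasurableSet.univ, Measure.restrict_univ]
    exact hab
  have habm : Measurable fun x => a x * b x := ham.mul hbm
  have hga : AEMeasurable (fun x => g x / a x) volume := hg.div ham.aemeasurable
  -- Hölder's inequality for `g / a` against the constant `1` in the measure `a b dx`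
  have hpq₀ : p₀.HolderConjugate p₀.conjExponent := Real.HolderConjugate.conjExponent hp₀
  have hgb : ∫⁻ x, g x * b x ≤ weightedNorm p₀ (fun x => a x ^ (1 - p₀) * b x) g := by
    have h := ENNReal.lintegral_mul_le_Lp_mul_Lq (volume.withDensity fun x => a x * b x) hpq₀
      (f := fun x => g x / a x) (g := fun _ => 1)
      (hga.mono_ac (withDensity_absolutelyContinuous _ _)) aemeasurable_const
    simp only [Pi.mul_apply, mul_one, ENNReal.one_rpow, lintegral_const, one_mul] at h
    rw [lintegral_withDensity_eq_lintegral_mul_density _ habm hga,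
      lintegral_withDensity_eq_lintegral_mul_density _ habm (hga.pow_const p₀)] at h
    have e1 : ∫⁻ x, g x / a x * (a x * b x) = ∫⁻ x, g x * b x := by
      refine lintegral_congr_ae ?_
      filter_upwards [hat] with x hx
      rw [← mul_assoc, ENNReal.div_mul_cancel (ha0 x) hx]
    have e2 : ∫⁻ x, (g x / a x) ^ p₀ * (a x * b x) =
        ∫⁻ x, g x ^ p₀ * (a x ^ (1 - p₀) * b x) := by
      refine lintegral_congr_ae ?_
      filter_upwards [hat] with x hx
      rw [ENNReal.div_rpow_of_nonneg _ _ hp₀0.le, div_eq_mul_inv, ← ENNReal.rpow_neg, mul_assoc,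
        ← mul_assoc _ (a x)]
      congr 2
      conv_lhs => enter [2]; rw [← ENNReal.rpow_one (a x)]
      rw [← ENNReal.rpow_add _ _ (ha0 x) hx, neg_add_eq_sub]
    rw [e1, e2] at h
    refine h.trans ?_
    refine (mul_le_mul_right (ENNReal.rpow_le_one hnu
      (one_div_pos.2 hpq₀.symm.pos).le) _).trans (mul_one _).le
  have hfn : weightedNorm p₀ (fun x => a x ^ (1 - p₀) * b x) f ≤ 2 * s := by
    have h : ∫⁻ x, f x ^ p₀ * (a x ^ (1 - p₀) * b x) ≤ (2 * s) ^ p₀ * 1 := by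
      calc ∫⁻ x, f x ^ p₀ * (a x ^ (1 - p₀) * b x)
          ≤ ∫⁻ x, (2 * s) ^ p₀ * (a x * b x) := by
            refine lintegral_mono_ae ?_
            filter_upwards [hfs, hat] with x hx hxa
            have h1 : f x ≤ 2 * s * a x := by
              refine hx.trans ?_
              calc s * F x ≤ s * (2 * a x) := by gcongr; exact hFa x
                _ = _ := by ring
            calc f x ^ p₀ * (a x ^ (1 - p₀) * b x)
                ≤ (2 * s * a x) ^ p₀ * (a x ^ (1 - p₀) * b x) := by gcongr
              _ = (2 * s) ^ p₀ * (a x ^ p₀ * a x ^ (1 - p₀) * b x) := by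
                  rw [ENNReal.mul_rpow_of_nonneg _ _ hp₀0.le]; ring
              _ = _ := by
                  rw [← ENNReal.rpow_add _ _ (ha0 x) hxa, add_sub_cancel, ENNReal.rpow_one]
        _ = (2 * s) ^ p₀ * ∫⁻ x, a x * b x := lintegral_const_mul _ habm
        _ ≤ _ := by gcongr
    rw [weightedNorm, one_div, ENNReal.rpow_inv_le_iff hp₀0]
    simpa using h
  calc ∫⁻ x, g x * H x * w x ≤ ∫⁻ x, 2 * (g x * b x) := by
        refine lintegral_mono fun x => ?_
        calc g x * H x * w x = g x * (H x * w x) := mul_assoc _ _ _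
          _ ≤ g x * (2 * b x) := mul_le_mul_right (hHb x) _
          _ = _ := by ring
    _ = 2 * ∫⁻ x, g x * b x := lintegral_const_mul' _ _ (by simp)
    _ ≤ 2 * (C * (2 * s)) := by
        gcongr
        exact hgb.trans (hfg.trans (by gcongr))
    _ = 4 * C * s := by ring

/-- Duality of `L^p(μ)` and `L^q(μ)`. -/
theorem exists_lt_lintegral_mul {α : Type*} [MeasurableSpace α] {μ : Measure α} [SigmaFinite μ]
    (hp : 1 < p) {g : α → ℝ≥0∞} {T : ℝ≥0∞} (hT : T < (∫⁻ x, g x ^ p ∂μ) ^ (1 / p)) :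
    ∃ H : α → ℝ≥0∞, Measurable H ∧ ∫⁻ x, H x ^ p.conjExponent ∂μ ≤ 1 ∧
      T < ∫⁻ x, g x * H x ∂μ := by
  have hp0 : 0 < p := by linarith
  have hpq : p.HolderConjugate p.conjExponent := Real.HolderConjugate.conjExponent hp
  have hq0 : 0 < p.conjExponent := hpq.symm.pos
  set q := p.conjExponent
  rw [one_div, ENNReal.lt_rpow_inv_iff hp0, lintegral_eq_nnreal] at hT
  simp only [lt_iSup_iff] at hT
  obtain ⟨φ₀, hφ₀, hT₀⟩ := hT
  rw [← SimpleFunc.lintegral_eq_lintegral] at hT₀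
  obtain ⟨φ, hφ, hφt, hTφ⟩ := SimpleFunc.exists_lt_lintegral_simpleFunc_of_lt_lintegral hT₀
  set I := ∫⁻ x, (φ x : ℝ≥0∞) ∂μ with hI
  have hI0 : I ≠ 0 := (pos_of_gt hTφ).ne'
  have hφm : Measurable fun x => (φ x : ℝ≥0∞) := φ.measurable.coe_nnreal_ennreal
  have hIq0 : I ^ (1 / q) ≠ 0 := (ENNReal.rpow_pos (pos_iff_ne_zero.2 hI0) hφt.ne).ne'
  have hIqt : (I ^ (1 / q))⁻¹ ≠ ∞ := ENNReal.inv_ne_top.2 hIq0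
  refine ⟨fun x => (φ x : ℝ≥0∞) ^ (1 / q) * (I ^ (1 / q))⁻¹, (hφm.pow_const _).mul_const _, ?_, ?_⟩
  · have e : ∀ x, ((φ x : ℝ≥0∞) ^ (1 / q) * (I ^ (1 / q))⁻¹) ^ q = φ x * I⁻¹ := by
      intro x
      rw [ENNReal.mul_rpow_of_nonneg _ _ hq0.le, ENNReal.inv_rpow, ← ENNReal.rpow_mul,
        ← ENNReal.rpow_mul, one_div_mul_cancel hq0.ne', ENNReal.rpow_one, ENNReal.rpow_one]
    simp only [e]
    rw [lintegral_mul_const _ hφm, ENNReal.mul_inv_cancel hI0 hφt.ne]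
  · have hg : ∀ x, (φ x : ℝ≥0∞) ^ (1 / p) ≤ g x := by
      intro x
      rw [one_div, ENNReal.rpow_inv_le_iff hp0]
      exact le_trans (by exact_mod_cast hφ x) (hφ₀ x)
    have hsum : ∀ y : ℝ≥0∞, y ^ (1 / p) * y ^ (1 / q) = y := by
      intro y
      rw [← ENNReal.rpow_add_of_nonneg _ _ (by positivity) (by positivity), one_div, one_div,
        hpq.inv_add_inv_eq_one, ENNReal.rpow_one]
    have hTI : T < I ^ (1 / p) := by rwa [one_div, ENNReal.lt_rpow_inv_iff hp0]
    refine hTI.trans_le ?_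
    calc I ^ (1 / p) = I * (I ^ (1 / q))⁻¹ := by
          conv_rhs => enter [1]; rw [← hsum I]
          rw [mul_assoc, ENNReal.mul_inv_cancel hIq0
            (ENNReal.rpow_ne_top_of_nonneg (by positivity) hφt.ne), mul_one]
      _ = ∫⁻ x, (φ x : ℝ≥0∞) ^ (1 / p) * ((φ x : ℝ≥0∞) ^ (1 / q) * (I ^ (1 / q))⁻¹) ∂μ := by
          simp only [← mul_assoc, hsum]
          rw [lintegral_mul_const _ hφm]
      _ ≤ _ := by gcongr with x; exact hg x

end Extrapolation

/-! ### Weights and norms up to null sets -/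

section NullSets

open Metric Set

variable {n : ℕ} {p : ℝ}

theorem weightedNorm_congr_weight {w v : (Fin n → ℝ) → ℝ≥0∞} (h : w =ᵐ[volume] v)
    (f : (Fin n → ℝ) → ℝ≥0∞) : weightedNorm p w f = weightedNorm p v f := by
  rw [weightedNorm, weightedNorm]
  congr 1
  refine lintegral_congr_ae ?_
  filter_upwards [h] with x hx
  rw [hx]

theorem weightedNorm_eq_zero_iff (hp : 0 < p) {w f : (Fin n → ℝ) → ℝ≥0∞}
    (hw : AEMeasurable w volume) (hpos : ∀ᵐ x ∂volume, 0 < w x) (hf : AEMeasurable f volume) :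
    weightedNorm p w f = 0 ↔ f =ᵐ[volume] 0 := by
  have h1 : weightedNorm p w f = 0 ↔ ∫⁻ x, f x ^ p * w x = 0 := by
    rw [weightedNorm, ENNReal.rpow_eq_zero_iff_of_pos (one_div_pos.2 hp)]
  have hm : AEMeasurable (fun x => f x ^ p * w x) volume := (hf.pow_const p).mul hw
  rw [h1, lintegral_eq_zero_iff' hm]
  constructor
  · intro h
    filter_upwards [h, hpos] with x hx hwx
    have : f x ^ p = 0 ∨ w x = 0 := by simpa using hx
    rcases this with h | h
    · exact (ENNReal.rpow_eq_zero_iff_of_pos hp).1 h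
    · exact absurd h hwx.ne'
  · intro h
    filter_upwards [h] with x hx
    simp [hx, hp]

theorem IsApWeight.ae_ne_top {w : (Fin n → ℝ) → ℝ≥0∞} (hw : IsApWeight p w) :
    ∀ᵐ x ∂volume, w x ≠ ∞ := by
  have key : ∀ k : ℕ, ∀ᵐ x ∂(volume.restrict (closedBall (0 : Fin n → ℝ) k)), w x ≠ ∞ := fun k =>
    (ae_lt_top' hw.aemeasurable.restrict
      (hw.locallyIntegrable _ (isCompact_closedBall _ _)).ne).mono fun _ hx => hx.ne
  have := (ae_restrict_iUnion_iff (μ := volume)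
    (fun k : ℕ => closedBall (0 : Fin n → ℝ) k) (fun y => w y ≠ ∞)).2 key
  rwa [iUnion_closedBall_nat, Measure.restrict_univ] at this

theorem IsApWeight.apConst_ne_zero (hp : 1 < p) {w : (Fin n → ℝ) → ℝ≥0∞} (hw : IsApWeight p w) :
    apConst p w ≠ 0 := by
  have hp1 : 0 < p - 1 := sub_pos.2 hp
  have h1 := laverage_cube_ne_zero (0 : Fin n → ℝ) one_pos hw.aemeasurable.restrict
    (ae_restrict_of_ae (hw.pos.mono fun _ hx => hx.ne'))
  have h2 := laverage_cube_ne_zero (a := fun x => w x ^ (-(1 / (p - 1)))) (0 : Fin n → ℝ) one_pos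
    (hw.aemeasurable.pow_const _).restrict
    (ae_restrict_of_ae (hw.ae_ne_top.mono fun _ hx => dualWeight_ne_zero hp hx))
  have h3 := le_apConst p w (0 : Fin n → ℝ) one_pos
  intro h
  rw [h, nonpos_iff_eq_zero, mul_eq_zero, ENNReal.rpow_eq_zero_iff_of_pos hp1] at h3
  exact h3.elim h1 h2

/-- An `A_p` weight agrees almost everywhere with one that is measurable and takes values in
`(0, ∞)` everywhere. -/
theorem IsApWeight.exists_ae_eq {w : (Fin n → ℝ) → ℝ≥0∞} (hw : IsApWeight p w) :
    ∃ v : (Fin n → ℝ) → ℝ≥0∞, w =ᵐ[volume] v ∧ Measurable v ∧ (∀ x, v x ≠ 0) ∧ (∀ x, v x ≠ ∞) := by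
  classical
  set m := hw.aemeasurable.mk w
  have hm : Measurable m := hw.aemeasurable.measurable_mk
  have hS : MeasurableSet {x | m x = 0 ∨ m x = ∞} :=
    (hm (measurableSet_singleton 0)).union (hm (measurableSet_singleton ∞))
  refine ⟨fun x => if m x = 0 ∨ m x = ∞ then 1 else m x, ?_, Measurable.ite hS measurable_const hm,
    fun x => ?_, fun x => ?_⟩
  · filter_upwards [hw.aemeasurable.ae_eq_mk, hw.pos, hw.ae_ne_top] with x hx h0 ht
    have hx' : w x = m x := hx
    rw [hx'] at h0 ht
    rw [if_neg (by rintro (h | h); exacts [h0.ne' h, ht h])]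
    exact hx'
  · simp only
    split_ifs with h
    · exact one_ne_zero
    · exact fun h' => h (Or.inl h')
  · simp only
    split_ifs with h
    · exact ENNReal.one_ne_top
    · exact fun h' => h (Or.inr h')

theorem isApWeight_one (n : ℕ) (p : ℝ) : IsApWeight p (fun _ : Fin n → ℝ => 1) := by
  refine ⟨aemeasurable_const, ae_of_all _ fun _ => one_pos, fun K hK => ?_, ?_⟩
  · simpa using hK.measure_lt_top
  · refine lt_of_le_of_lt (iSup_le fun c => iSup₂_le fun l hl => ?_) ENNReal.one_lt_top
    simp only [ENNReal.one_rpow, setLAverage_eq, setLIntegral_const, one_mul]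
    rw [ENNReal.div_self (volume_cube_ne_zero c hl) (volume_cube_ne_top c l), ENNReal.one_rpow,
      one_mul]

end NullSets

/-! ### Extrapolation for families -/

section Families

open Set

variable {n : ℕ} {p p₀ : ℝ}

/-- If `g` vanishes with `f` in one space `L^{p₀}(u)`, a strict inequality `C ‖f‖ < ‖g‖` forces
`0 < ‖f‖ < ∞`, provided `C ≠ 0`. -/
theorem weightedNorm_ne_zero_ne_top (hp : 0 < p) (hp₀ : 1 < p₀) {w f g : (Fin n → ℝ) → ℝ≥0∞}
    (hw : AEMeasurable w volume) (hpos : ∀ᵐ x ∂volume, 0 < w x)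
    (hf : AEMeasurable f volume) (hg : AEMeasurable g volume)
    (h : ∀ u : (Fin n → ℝ) → ℝ≥0∞, IsApWeight p₀ u →
      ∃ C : ℝ≥0, weightedNorm p₀ u g ≤ C * weightedNorm p₀ u f)
    {C : ℝ≥0∞} (hC : C ≠ 0) (hlt : C * weightedNorm p w f < weightedNorm p w g) :
    weightedNorm p w f ≠ 0 ∧ weightedNorm p w f ≠ ∞ := by
  have hp₀0 : 0 < p₀ := by linarith
  constructor
  · intro h0
    obtain ⟨D, hD⟩ := h _ (isApWeight_one n p₀)
    have h1 := isApWeight_one n p₀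
    rw [(weightedNorm_eq_zero_iff hp₀0 h1.aemeasurable h1.pos hf).2
      ((weightedNorm_eq_zero_iff hp hw hpos hf).1 h0), mul_zero, nonpos_iff_eq_zero,
      weightedNorm_eq_zero_iff hp₀0 h1.aemeasurable h1.pos hg,
      ← weightedNorm_eq_zero_iff hp hw hpos hg] at hD
    rw [hD] at hlt
    exact not_lt_zero hlt
  · intro ht
    rw [ht, ENNReal.mul_top hC] at hlt
    exact not_top_lt hlt

/-- A function of finite nonzero norm can be normalized; the result is taken measurable. -/
theorem exists_measurable_normalized (hp : 0 < p) {w f : (Fin n → ℝ) → ℝ≥0∞}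
    (hf : AEMeasurable f volume)
    (h0 : weightedNorm p w f ≠ 0) (ht : weightedNorm p w f ≠ ∞) :
    ∃ F : (Fin n → ℝ) → ℝ≥0∞, Measurable F ∧ ∫⁻ x, F x ^ p * w x ≤ 1 ∧
      (∀ᵐ x ∂volume, f x = weightedNorm p w f * F x) := by
  set N := weightedNorm p w f with hN
  have hNt : N⁻¹ ≠ ∞ := ENNReal.inv_ne_top.2 h0
  refine ⟨fun x => N⁻¹ * hf.mk f x, hf.measurable_mk.const_mul _, ?_, ?_⟩
  · have hNp : ∫⁻ x, f x ^ p * w x = N ^ p := by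
      rw [hN, weightedNorm, ← ENNReal.rpow_mul, one_div_mul_cancel hp.ne', ENNReal.rpow_one]
    calc ∫⁻ x, (N⁻¹ * hf.mk f x) ^ p * w x = ∫⁻ x, (N⁻¹) ^ p * (f x ^ p * w x) := by
          refine lintegral_congr_ae ?_
          filter_upwards [hf.ae_eq_mk] with x hx
          rw [← hx, ENNReal.mul_rpow_of_nonneg _ _ hp.le, mul_assoc]
      _ = (N⁻¹ * N) ^ p := by
          rw [lintegral_const_mul' _ _ (ENNReal.rpow_ne_top_of_nonneg hp.le hNt), hNp,
            ENNReal.mul_rpow_of_nonneg _ _ hp.le]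
      _ ≤ 1 := by rw [ENNReal.inv_mul_cancel h0 ht, ENNReal.one_rpow]
  · filter_upwards [hf.ae_eq_mk] with x hx
    rw [← hx, ← mul_assoc, ENNReal.mul_inv_cancel h0 ht, one_mul]

theorem not_ae_eq_zero_of_weightedNorm_ne_zero (hp : 0 < p) {w f F : (Fin n → ℝ) → ℝ≥0∞}
    {s : ℝ≥0∞} (h0 : weightedNorm p w f ≠ 0) (h : ∀ᵐ x ∂volume, f x ≤ s * F x) :
    ¬ F =ᵐ[volume] 0 := by
  intro hF
  refine h0 ?_
  rw [weightedNorm, ENNReal.rpow_eq_zero_iff_of_pos (one_div_pos.2 hp)]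
  refine (lintegral_congr_ae ?_).trans lintegral_zero
  filter_upwards [h, hF] with x hx hFx
  rw [hFx] at hx
  have : f x = 0 := by simpa using hx
  simp [this, hp]

/-- The norm of `L^p(w)` is attained up to any error on the unit ball of the dual. -/
theorem exists_lt_lintegral_mul_weight (hp : 1 < p) {w g : (Fin n → ℝ) → ℝ≥0∞} (hw : Measurable w)
    (ht : ∀ x, w x ≠ ∞) (hg : AEMeasurable g volume) {T : ℝ≥0∞} (hT : T < weightedNorm p w g) :
    ∃ H : (Fin n → ℝ) → ℝ≥0∞, Measurable H ∧ ∫⁻ x, H x ^ p.conjExponent * w x ≤ 1 ∧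
      T < ∫⁻ x, g x * H x * w x := by
  have := SigmaFinite.withDensity_of_ne_top' (μ := (volume : Measure (Fin n → ℝ))) ht
  rw [weightedNorm, ← lintegral_withDensity_eq_lintegral_mul_density _ hw (hg.pow_const p)] at hT
  obtain ⟨H, hH, h1, h2⟩ := exists_lt_lintegral_mul hp hT
  rw [lintegral_withDensity_eq_lintegral_mul_density _ hw (hH.pow_const _).aemeasurable] at h1
  have hm : AEMeasurable (fun x => g x * H x) volume := hg.mul hH.aemeasurable
  rw [lintegral_withDensity_eq_lintegral_mul_density _ hw hm] at h2
  exact ⟨H, hH, h1, h2⟩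

theorem not_ae_eq_zero_of_lt_lintegral_mul {w g H H' : (Fin n → ℝ) → ℝ≥0∞} {T s : ℝ≥0∞}
    (h : T < ∫⁻ x, g x * H x * w x) (hH : ∀ x, H x ≤ s * H' x) : ¬ H' =ᵐ[volume] 0 := by
  intro h0
  refine (pos_of_gt h).ne' ?_
  refine (lintegral_congr_ae ?_).trans lintegral_zero
  filter_upwards [h0] with x hx
  have := hH x
  rw [hx] at this
  have : H x = 0 := by simpa using this
  simp [this]

/-- Extrapolation with constants that depend on the weight arbitrarily. If no constant works, there
are pairs `(f k, g k)` that violate the inequality with constants `8 ^ k`; the functions `f k` and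
the corresponding dual functions are superposed with coefficients `2 ^ (-(k + 1))`, so that one
`A_{p₀}` weight serves all the pairs. -/
theorem exists_weightedNorm_le_of_forall_exists (hp₀ : 1 < p₀)
    {F : Set (((Fin n → ℝ) → ℝ≥0∞) × ((Fin n → ℝ) → ℝ≥0∞))}
    (hF : ∀ q ∈ F, AEMeasurable q.1 volume ∧ AEMeasurable q.2 volume)
    (h : ∀ u : (Fin n → ℝ) → ℝ≥0∞, IsApWeight p₀ u →
      ∃ C : ℝ≥0, ∀ q ∈ F, weightedNorm p₀ u q.2 ≤ C * weightedNorm p₀ u q.1)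
    (hp : 1 < p) {w : (Fin n → ℝ) → ℝ≥0∞} (hw : IsApWeight p w) :
    ∃ C : ℝ≥0, ∀ q ∈ F, weightedNorm p w q.2 ≤ C * weightedNorm p w q.1 := by
  have hp0 : 0 < p := by linarith
  have hq : 1 < p.conjExponent := (Real.HolderConjugate.conjExponent hp).symm.lt
  obtain ⟨v, hwv, hv, hv0, hvt⟩ := hw.exists_ae_eq
  simp only [weightedNorm_congr_weight hwv]
  have hA : apConst p v ≠ ∞ := by
    rw [← apConst_congr_ae hwv]
    exact hw.apConst_lt_top.ne
  by_contra! hcon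
  choose P hPF hP using fun k : ℕ => hcon (8 ^ k)
  have hN : ∀ k, weightedNorm p v (P k).1 ≠ 0 ∧ weightedNorm p v (P k).1 ≠ ∞ := fun k =>
    weightedNorm_ne_zero_ne_top hp0 hp₀ hv.aemeasurable
      (ae_of_all _ fun x => pos_iff_ne_zero.2 (hv0 x)) (hF _ (hPF k)).1 (hF _ (hPF k)).2
      (fun u hu => (h u hu).imp fun C hC => hC _ (hPF k))
      (by simp) (hP k)
  choose f hfm hf1 hfe using fun k =>
    exists_measurable_normalized hp0 (hF _ (hPF k)).1 (hN k).1 (hN k).2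
  choose H hHm hH1 hHg using fun k =>
    exists_lt_lintegral_mul_weight hp hv hvt (hF _ (hPF k)).2 (hP k)
  set N : ℕ → ℝ≥0∞ := fun k => weightedNorm p v (P k).1
  set Fs : (Fin n → ℝ) → ℝ≥0∞ := fun x => ∑' k, (2⁻¹ : ℝ≥0∞) ^ (k + 1) * f k x
  set Hs : (Fin n → ℝ) → ℝ≥0∞ := fun x => ∑' k, (2⁻¹ : ℝ≥0∞) ^ (k + 1) * H k x
  have hFle : ∀ k x, f k x ≤ 2 ^ (k + 1) * Fs x := fun k x => le_two_pow_mul_tsum (fun j => f j x) k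
  have hHle : ∀ k x, H k x ≤ 2 ^ (k + 1) * Hs x := fun k x => le_two_pow_mul_tsum (fun j => H j x) k
  have hPle : ∀ k, ∀ᵐ x ∂volume, (P k).1 x ≤ (N k * 2 ^ (k + 1)) * Fs x := by
    intro k
    filter_upwards [hfe k] with x hx
    rw [hx, mul_assoc]
    gcongr
    exact hFle k x
  have hsum : ∀ {r : ℝ}, 1 < r → ∀ {a : ℕ → (Fin n → ℝ) → ℝ≥0∞}, (∀ k, Measurable (a k)) →
      (∀ k, ∫⁻ x, a k x ^ r * v x ≤ 1) →
      ∫⁻ x, (∑' k, (2⁻¹ : ℝ≥0∞) ^ (k + 1) * a k x) ^ r * v x ≤ 1 := by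
    intro r hr a ha h1
    have hm : Measurable fun x => ∑' k, (2⁻¹ : ℝ≥0∞) ^ (k + 1) * a k x :=
      Measurable.tsum fun k => (ha k).const_mul _
    rw [← lintegral_withDensity_eq_lintegral_mul_density _ hv (hm.pow_const r).aemeasurable]
    refine lintegral_tsum_rpow_le hr ha fun k => ?_
    rw [lintegral_withDensity_eq_lintegral_mul_density _ hv ((ha k).pow_const r).aemeasurable]
    exact h1 k
  obtain ⟨K, -, hK⟩ := exists_isApWeight_forall_lintegral_mul_le n hp₀ hp
  obtain ⟨u, hu, -, hug⟩ := hK v hv hv0 hvt hA Fs Hs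
    (Measurable.tsum fun k => (hfm k).const_mul _)
    (Measurable.tsum fun k => (hHm k).const_mul _)
    (not_ae_eq_zero_of_weightedNorm_ne_zero hp0 (hN 0).1 (hPle 0))
    (not_ae_eq_zero_of_lt_lintegral_mul (hHg 0) (hHle 0)) (hsum hp hfm hf1) (hsum hq hHm hH1)
  obtain ⟨C, hC⟩ := h u hu
  have hlt : ∀ k : ℕ, (2 : ℝ≥0∞) ^ k < 16 * C := by
    intro k
    have h1 := hug (P k).1 (P k).2 (hF _ (hPF k)).2 C _ (hPle k) (hC _ (hPF k))
    have h2 : ∫⁻ x, (P k).2 x * H k x * v x ≤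
        2 ^ (k + 1) * ∫⁻ x, (P k).2 x * Hs x * v x := by
      rw [← lintegral_const_mul' _ _ (by finiteness)]
      refine lintegral_mono fun x => ?_
      calc (P k).2 x * H k x * v x ≤ (P k).2 x * (2 ^ (k + 1) * Hs x) * v x := by
            gcongr
            exact hHle k x
        _ = _ := by ring
    have h3 : (4 ^ k * N k) * 2 ^ k < (4 ^ k * N k) * (16 * C) := by
      calc (4 ^ k * N k) * 2 ^ k = 8 ^ k * N k := by
            rw [show (8 : ℝ≥0∞) = 4 * 2 by norm_num, mul_pow]; ring
        _ < ∫⁻ x, (P k).2 x * H k x * v x := by simpa using hHg k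
        _ ≤ 2 ^ (k + 1) * (4 * C * (N k * 2 ^ (k + 1))) := by
            refine h2.trans ?_
            gcongr
        _ = _ := by
            rw [show (4 : ℝ≥0∞) ^ k = 2 ^ k * 2 ^ k by rw [← mul_pow]; norm_num]
            ring
    exact lt_of_mul_lt_mul_left' h3
  obtain ⟨k, hk⟩ := pow_unbounded_of_one_lt (16 * C : ℝ≥0) one_lt_two
  exact absurd (hlt k) (not_lt.2 (by exact_mod_cast hk.le))

/-- Extrapolation for one pair, with constants controlled by the Muckenhoupt constants. -/
theorem exists_isLocallyBdd_weightedNorm_le (n : ℕ) (hp₀ : 1 < p₀) {φ : ℝ≥0 → ℝ≥0}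
    (hφ : IsLocallyBdd φ) (hp : 1 < p) :
    ∃ ψ : ℝ≥0 → ℝ≥0, IsLocallyBdd ψ ∧
      ∀ f g : (Fin n → ℝ) → ℝ≥0∞, AEMeasurable f volume → AEMeasurable g volume →
        (∀ u : (Fin n → ℝ) → ℝ≥0∞, IsApWeight p₀ u →
          weightedNorm p₀ u g ≤ φ (apConst p₀ u).toNNReal * weightedNorm p₀ u f) →
        ∀ w : (Fin n → ℝ) → ℝ≥0∞, IsApWeight p w →
          weightedNorm p w g ≤ ψ (apConst p w).toNNReal * weightedNorm p w f := by
  have hp0 : 0 < p := by linarith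
  obtain ⟨K, hKm, hK⟩ := exists_isApWeight_forall_lintegral_mul_le n hp₀ hp
  -- the summand `1` keeps `ψ` away from `0`, where `ψ * ∞` would be `0`
  let ψ : ℝ≥0 → ℝ≥0 := fun t => 4 * sSup (φ '' Ioo 0 (K t + 1)) + 1
  have hmono : Monotone ψ := by
    intro s t hst
    simp only [ψ]
    gcongr ?_ + 1
    have hmem : (K s + 1) / 2 ∈ Ioo 0 (K s + 1) :=
      ⟨by positivity, NNReal.half_lt_self (by positivity)⟩
    have hsub : Ioo 0 (K s + 1) ⊆ Ioo 0 (K t + 1) :=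
      Ioo_subset_Ioo_right (by gcongr; exact hKm hst)
    exact mul_le_mul_right
      (csSup_le_csSup (hφ _) ⟨_, mem_image_of_mem φ hmem⟩ (image_mono hsub)) 4
  refine ⟨ψ, fun M => ⟨ψ M, ?_⟩, fun f g hf hg h w hw => ?_⟩
  · rintro _ ⟨t, ht, rfl⟩
    exact hmono ht.2.le
  obtain ⟨v, hwv, hv, hv0, hvt⟩ := hw.exists_ae_eq
  have hA : apConst p v ≠ ∞ := by
    rw [← apConst_congr_ae hwv]
    exact hw.apConst_lt_top.ne
  rw [apConst_congr_ae hwv, weightedNorm_congr_weight hwv, weightedNorm_congr_weight hwv]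
  by_contra! hlt
  obtain ⟨hN0, hNt⟩ := weightedNorm_ne_zero_ne_top hp0 hp₀ hv.aemeasurable
    (ae_of_all _ fun x => pos_iff_ne_zero.2 (hv0 x)) hf hg (fun u hu => ⟨_, h u hu⟩)
    (by simp [ψ]) hlt
  obtain ⟨F, hFm, hF1, hFe⟩ := exists_measurable_normalized hp0 hf hN0 hNt
  obtain ⟨H, hHm, hH1, hHg⟩ := exists_lt_lintegral_mul_weight hp hv hvt hg hlt
  have hFle : ∀ᵐ x ∂volume, f x ≤ weightedNorm p v f * F x := hFe.mono fun x hx => hx.le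
  obtain ⟨u, hu, huK, hug⟩ := hK v hv hv0 hvt hA F H hFm hHm
    (not_ae_eq_zero_of_weightedNorm_ne_zero hp0 hN0 hFle)
    (not_ae_eq_zero_of_lt_lintegral_mul hHg (s := 1) fun x => by simp) hF1 hH1
  have h1 := hug f g hg _ _ hFle (h u hu)
  have h2 : 4 * φ (apConst p₀ u).toNNReal ≤ ψ (apConst p v).toNNReal := by
    have hle : (apConst p₀ u).toNNReal ≤ K (apConst p v).toNNReal :=
      (ENNReal.toNNReal_mono ENNReal.coe_ne_top huK).trans_eq (ENNReal.toNNReal_coe _)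
    have hmem : (apConst p₀ u).toNNReal ∈ Ioo 0 (K (apConst p v).toNNReal + 1) :=
      ⟨ENNReal.toNNReal_pos (hu.apConst_ne_zero hp₀) hu.apConst_lt_top.ne,
        hle.trans_lt (lt_add_one _)⟩
    exact (mul_le_mul_right (le_csSup (hφ _) (mem_image_of_mem φ hmem)) 4).trans le_self_add
  refine absurd (hHg.trans_le h1) (not_lt.2 ?_)
  gcongr
  exact_mod_cast h2

end Families

theorem theorem4p1 (n : ℕ) (hn : 1 ≤ n) (p₀ : ℝ) (hp₀ : 1 < p₀) :
    -- constants that depend on the weight in an arbitrary way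
    (∀ F : Set (((Fin n → ℝ) → ℝ≥0∞) × ((Fin n → ℝ) → ℝ≥0∞)),
      (∀ q ∈ F, AEMeasurable q.1 volume ∧ AEMeasurable q.2 volume) →
      (∀ u : (Fin n → ℝ) → ℝ≥0∞, IsApWeight p₀ u →
        ∃ C : ℝ≥0, ∀ q ∈ F, weightedNorm p₀ u q.2 ≤ C * weightedNorm p₀ u q.1) →
      ∀ p : ℝ, 1 < p → ∀ w : (Fin n → ℝ) → ℝ≥0∞, IsApWeight p w →
        ∃ C : ℝ≥0, ∀ q ∈ F, weightedNorm p w q.2 ≤ C * weightedNorm p w q.1) ∧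
    -- constants that depend on the weight only through its Muckenhoupt constant
    (∀ φ : ℝ≥0 → ℝ≥0, IsLocallyBdd φ → ∀ p : ℝ, 1 < p →
      ∃ ψ : ℝ≥0 → ℝ≥0, IsLocallyBdd ψ ∧
        ∀ f g : (Fin n → ℝ) → ℝ≥0∞, AEMeasurable f volume → AEMeasurable g volume →
          (∀ u : (Fin n → ℝ) → ℝ≥0∞, IsApWeight p₀ u →
            weightedNorm p₀ u g ≤ φ (apConst p₀ u).toNNReal * weightedNorm p₀ u f) →
          ∀ w : (Fin n → ℝ) → ℝ≥0∞, IsApWeight p w →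
            weightedNorm p w g ≤ ψ (apConst p w).toNNReal * weightedNorm p w f) :=
  ⟨fun _ hF h _ hp _ hw => exists_weightedNorm_le_of_forall_exists hp₀ hF h hp hw,
    fun _ hφ _ hp => exists_isLocallyBdd_weightedNorm_le n hp₀ hφ hp⟩
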